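/- Let $F$ (facilities) and $C$ (clients) be finite sets and $T$ a number of time steps. Let $f_i\ge 0$ be the opening cost of $i\in F$ and, for each time step $t\in\{1,\dots,T\}$, let $d_t$ be a (pseudo)metric on $F\sqcup C$. Let $x^t=(x^t_{ij})_{i\in F,j\in C}$ and $y^t=(y^t_i)_{i\in F}$, for $1\le t\le T$, be nonnegative reals with $\sum_{i\in F}x^t_{ij}=1$ for all $j$ and $x^t_{ij}\le y^t_i$ for all $i,j$. Assume that $x^t_{ij}\in\{0,y^t_i\}$ for all $i,j,t$, and that there are $o_i\in[0,1]$ with $y^t_i\in\{0,o_i\}$ for all $i,t$. Let $Q_i$ ($i\in F$) and $R_j$ ($j\in C$) be mutually independent real random variables with $Q_i\sim\mathrm{Exp}(o_i)$ whenever $o_i>0$ (if $o_i=0$ the law of $Q_i$ is arbitrary, and $i$ is never used), and $R_j\sim\mathrm{Exp}(1)$. These clocks are sampled once and used at all time steps. At each time step $t$ run the following procedure. Let $G_t$ be the bipartite graph on $F\sqcup C$ with an edge $\{i,j\}$ iff $x^t_{ij}>0$, and let the connection graph have, from each non-isolated vertex of $G_t$, exactly one outgoing arc, towards its neighbour in $G_t$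 with the smallest clock (ties have probability $0$ and are broken arbitrarily). Facility $i$ is opened iff it lies on a length-2 cycle of the connection graph. The connection path of a client $j$ starts at $j$ and follows outgoing arcs until just before it would visit an already visited vertex; $j$ is connected to the facility that appears latest on this path. Let $Y^t_i$ be the indicator that $i$ is opened, and $X^t_{ij}$ the indicator that $j$ is connected to $i$, at time $t$. Then for every $t\in\{1,\dots,T\}$ the random variables below are integrable and $$\mathbb E\Big[\sum_{i\in F} f_iY^t_i\Big]\le\sum_{i\in F} f_iy^t_i,\qquad \mathbb E\Big[\sum_{i\in F,\,j\in C} d_t(i,j)X^t_{ij}\Big]\le 6\sum_{i\in F,\,j\in C} d_t(i,j)x^t_{ij},$$ and, if $t<T$, $$\mathbb E\big[\,\big|\{j\in C: X^t_{ij}\ne X^{t+1}_{ij}\text{ for some } i\in F\}\big|\,\big]\le 7\,|Z^t|,\qquad Z^t=\{j\in C: x^t_{ij}\neq x^{t+1}_{ij}\text{ for some } i\in F\}.$$ -/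

import Mathlib

open MeasureTheory ProbabilityTheory

namespace DynFacLoc

/-- Membership in the facility-location polytope: `x i j` is the fractional connection of client `j`
to facility `i`, and `y i` is the fractional opening of facility `i`. -/
structure InPFL {F C : Type*} [Fintype F] (x : F → C → ℝ) (y : F → ℝ) : Prop where
  sum_eq_one : ∀ j, ∑ i, x i j = 1
  le_open : ∀ i j, x i j ≤ y i
  conn_nonneg : ∀ i j, 0 ≤ x i j
  open_nonneg : ∀ i, 0 ≤ y i

/-- The support graph of `x`: the bipartite graph on facilities (`Sum.inl`) and clients (`Sum.inr`)
with an edge `{i, j}` iff `x i j > 0`. Facilities without any edge stay as isolated vertices; they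
play no role below. -/
def supportGraph {F C : Type*} (x : F → C → ℝ) : SimpleGraph (F ⊕ C) where
  Adj u v := (∃ i j, u = Sum.inl i ∧ v = Sum.inr j ∧ 0 < x i j) ∨
    (∃ i j, u = Sum.inr j ∧ v = Sum.inl i ∧ 0 < x i j)
  symm := ⟨by
    rintro u v (⟨i, j, hu, hv, h⟩ | ⟨i, j, hu, hv, h⟩)
    · exact Or.inr ⟨i, j, hv, hu, h⟩
    · exact Or.inl ⟨i, j, hv, hu, h⟩⟩
  loopless := ⟨by
    rintro u (⟨i, j, hu, hv, -⟩ | ⟨i, j, hu, hv, -⟩)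
    · exact absurd (hu.symm.trans hv) (by simp)
    · exact absurd (hu.symm.trans hv) (by simp)⟩

/-- `w` is a neighbour of `v` in `G` whose clock is smallest among all neighbours of `v`. -/
def IsSmallestNbr {V : Type*} (G : SimpleGraph V) (clock : V → ℝ) (v w : V) : Prop :=
  G.Adj v w ∧ ∀ u, G.Adj v u → clock w ≤ clock u

open Classical in
/-- The head of the unique outgoing arc of `v` in the connection graph: the neighbour of `v` with the
smallest clock (ties, which have probability zero, are broken by an arbitrary fixed choice).
An isolated vertex, which has no outgoing arc, is sent to itself by convention. -/
noncomputable def arcHead {V : Type*} (G : SimpleGraph V) (clock : V → ℝ) (v : V) : V :=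
  if h : ∃ w, IsSmallestNbr G clock v w then h.choose else v

theorem exists_revisit {V : Type*} [Finite V] (s : V → V) (v : V) :
    ∃ n : ℕ, ∃ m ≤ n, s^[n + 1] v = s^[m] v := by
  obtain ⟨a, b, hne, hab⟩ := Finite.exists_ne_map_eq_of_infinite (fun n : ℕ => s^[n] v)
  rcases Nat.lt_or_gt_of_ne hne with h | h
  · obtain ⟨n, rfl⟩ := Nat.exists_eq_add_of_lt h
    exact ⟨a + n, a, by omega, hab.symm⟩
  · obtain ⟨n, rfl⟩ := Nat.exists_eq_add_of_lt h
    exact ⟨b + n, b, by omega, hab⟩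

/-- The number of arcs of the path that starts at `v` and follows `s` until it is about to visit a
vertex that it has already visited. In a finite graph this is a minimum over a nonempty set, see
`exists_revisit`. -/
noncomputable def pathLength {V : Type*} (s : V → V) (v : V) : ℕ :=
  sInf {n : ℕ | ∃ m ≤ n, s^[n + 1] v = s^[m] v}

/-- The list of vertices, in order, of the connection path of client `j`. -/
noncomputable def connPath {F C : Type*} (x : F → C → ℝ)
    (clock : F ⊕ C → ℝ) (j : C) : List (F ⊕ C) :=
  let s := arcHead (supportGraph x) clock
  (List.range (pathLength s (Sum.inr j) + 1)).map fun n => s^[n] (Sum.inr j)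

/-- The facility to which client `j` is assigned: the one appearing latest on its connection path. -/
noncomputable def assigned {F C : Type*} (x : F → C → ℝ)
    (clock : F ⊕ C → ℝ) (j : C) : Option F :=
  ((connPath x clock j).filterMap Sum.getLeft?).getLast?

/-- Facility `i` is opened iff it lies on a cycle of length two of the connection graph. -/
def IsOpened {F C : Type*} (x : F → C → ℝ) (clock : F ⊕ C → ℝ) (i : F) : Prop :=
  ∃ j : C, arcHead (supportGraph x) clock (Sum.inl i) = Sum.inr j ∧
    arcHead (supportGraph x) clock (Sum.inr j) = Sum.inl i

open Classical in
/-- The indicator `X i j` that client `j` is connected to facility `i`. -/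
noncomputable def connInd {F C : Type*} (x : F → C → ℝ)
    (clock : F ⊕ C → ℝ) (i : F) (j : C) : ℝ :=
  if assigned x clock j = some i then 1 else 0

open Classical in
/-- The indicator `Y i` that facility `i` is opened. -/
noncomputable def openInd {F C : Type*} (x : F → C → ℝ) (clock : F ⊕ C → ℝ) (i : F) : ℝ :=
  if IsOpened x clock i then 1 else 0

open Classical in
/-- The number of clients whose connection differs when the algorithm is run on `x` and on `x'`
with the same clocks. -/
noncomputable def numSwitching {F C : Type*} [Fintype C] (x x' : F → C → ℝ)
    (clock : F ⊕ C → ℝ) : ℝ :=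
  ∑ j : C, if ∃ i : F, connInd x clock i j ≠ connInd x' clock i j then 1 else 0

/-- The set of clients whose fractional connection differs in `x` and `x'`. -/
def changedClients {F C : Type*} (x x' : F → C → ℝ) : Set C :=
  {j | ∃ i, x i j ≠ x' i j}

end DynFacLoc

/-! Each vertex of a connection path has the smallest clock among the neighbours of its predecessor,
so clocks never increase along the facilities of the path, nor along its clients. Hence the facility
chosen at a client minimizes the clock over all facilities adjacent to any client visited so far
and, barring ties, is adjacent to none of the earlier ones. The same holds for clients
(`NoRevisit.fac_step`, `NoRevisit.cli_step`). A path prefix thus forces nested argmin events on the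
facility clocks and on the client clocks, and the two families are independent. For exponential
clocks such a nested family has probability at most the product of the ratios rate of the winner /
rate of the competitors (`ChainBound.argmin`).

These products are summed over all prefixes ending at a given client. Client factors average over
the neighbours of a facility and cost nothing. If `j, i', j'` are consecutive on the path, the
facility entering `j` lies in `N(j) \ N(j')`, of rate a ≤ 1, while the choice at `j'` competes
against at least `N(j) ∪ N(j')`, of rate 1 + a; so each earlier facility contributes a/(1 + a) ≤
1/2. Therefore the expected number of clients whose path crosses an edge ij in a given direction at
its k-th opportunity is at most `x i j * geo k`, and `geo` sums to at most 3
(`sum_measure_traverse_up_le`, `sum_measure_traverse_down_le`).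

By the triangle inequality, connection costs are charged to the crossed edges: two directions give
6. A client switches only if it has changed itself, or if one of its two paths enters a changed
client: this gives 1 + 3 + 3 = 7. Opening is the mutual choice of `i` and some neighbour, of total
probability at most `o i`. -/

namespace DynFacLoc

/-! ### Tails of exponential laws -/

theorem expMeasure_eq_withDensity (r : ℝ) :
    expMeasure r = volume.withDensity (exponentialPDF r) := rfl

instance nullSingletonClass_expMeasure (r : ℝ) : NullSingletonClass (expMeasure r) where
  measure_singleton q := by
    rw [expMeasure_eq_withDensity]
    exact withDensity_absolutelyContinuous _ _ Real.volume_singleton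

theorem expMeasure_Ici {r : ℝ} (hr : 0 < r) {s : ℝ} (hs : 0 ≤ s) :
    expMeasure r (Set.Ici s) = ENNReal.ofReal (Real.exp (-(r * s))) := by
  have := isProbabilityMeasure_expMeasure hr
  rw [← Ioi_ae_eq_Ici.measure_eq, ← Set.compl_Iic]
  have h := cdf_expMeasure_eq hr s
  rw [if_pos hs, cdf_eq_real] at h
  have h2 : (expMeasure r).real (Set.Iic s)ᶜ = Real.exp (-(r * s)) := by
    rw [probReal_compl_eq_one_sub measurableSet_Iic, h]; ring
  rw [← h2, ofReal_measureReal]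

/-- Tilting an exponential density gives another one up to a constant; that constant is the
probability of winning against competitors of total rate κ. -/
theorem exponentialPDF_mul_exp {r κ : ℝ} (hr : 0 < r) (hκ : 0 ≤ κ) (q : ℝ) :
    exponentialPDF r q * ENNReal.ofReal (Real.exp (-(κ * q))) =
      ENNReal.ofReal (r / (r + κ)) * exponentialPDF (r + κ) q := by
  rcases lt_or_ge q 0 with hq | hq
  · simp [exponentialPDF_of_neg hq]
  · rw [exponentialPDF_of_nonneg hq, exponentialPDF_of_nonneg hq,
      ← ENNReal.ofReal_mul (by positivity), ← ENNReal.ofReal_mul (by positivity)]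
    congr 1
    rw [mul_assoc, ← Real.exp_add, ← mul_assoc, div_mul_cancel₀ _ (by positivity)]
    congr 2; ring

theorem lintegral_expMeasure_tail {r κ : ℝ} (hr : 0 < r) (hκ : 0 ≤ κ) {s : ℝ} (hs : 0 ≤ s) :
    ∫⁻ q in Set.Ici s, ENNReal.ofReal (Real.exp (-(κ * q))) ∂(expMeasure r) =
      ENNReal.ofReal (r / (r + κ) * Real.exp (-((r + κ) * s))) := by
  have hm : ∀ r, Measurable (exponentialPDF r) := fun r =>
    (measurable_exponentialPDFReal r).ennreal_ofReal
  rw [expMeasure_eq_withDensity, setLIntegral_withDensity_eq_setLIntegral_mul _ (hm r)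
    (by fun_prop) measurableSet_Ici]
  simp only [Pi.mul_apply, exponentialPDF_mul_exp hr hκ]
  rw [lintegral_const_mul _ (hm _), ← withDensity_apply _ measurableSet_Ici,
    ← expMeasure_eq_withDensity, expMeasure_Ici (by linarith) hs,
    ENNReal.ofReal_mul (by positivity)]

/-! ### Nested argmin events of independent exponential clocks -/

/-- Independent clocks, those with positive rate being exponential. -/
structure ExpClocks {V Ω : Type*} [MeasurableSpace Ω] (rate : V → ℝ) (Z : V → Ω → ℝ)
    (P : Measure Ω) : Prop where
  measurable : ∀ v, Measurable (Z v)
  law : ∀ v, 0 < rate v → HasLaw (Z v) (expMeasure (rate v)) P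
  indep : iIndepFun Z P

/-- The σ-algebra generated by the clocks in `U`. -/
abbrev clockAlg {V Ω : Type*} (Z : V → Ω → ℝ) (U : Set V) : MeasurableSpace Ω :=
  ⨆ u ∈ U, MeasurableSpace.comap (Z u) inferInstance

theorem clockAlg_mono {V Ω : Type*} (Z : V → Ω → ℝ) {U W : Set V} (h : U ⊆ W) :
    clockAlg Z U ≤ clockAlg Z W :=
  biSup_mono fun _ hu => h hu

theorem measurable_clockAlg {V Ω : Type*} (Z : V → Ω → ℝ) {U : Set V} {u : V} (hu : u ∈ U) :
    Measurable[clockAlg Z U] (Z u) :=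
  measurable_iff_comap_le.2 (le_biSup (fun u => MeasurableSpace.comap (Z u) inferInstance) hu)

/-- `X` is an event about the clocks in `U` whose probability, jointly with all these clocks being
at least `s`, is at most `c` times the probability of the latter. -/
structure ChainBound {V Ω : Type*} [MeasurableSpace Ω] (rate : V → ℝ) (Z : V → Ω → ℝ)
    (P : Measure Ω) (U : Finset V) (X : Set Ω) (c : ℝ) : Prop where
  measurableSet : MeasurableSet[clockAlg Z (U : Set V)] X
  pos : ∀ u ∈ U, 0 < rate u
  nonneg : 0 ≤ c
  bound : ∀ s, 0 ≤ s →
    P (X ∩ {ω | ∀ u ∈ U, s ≤ Z u ω}) ≤ ENNReal.ofReal (c * Real.exp (-((∑ u ∈ U, rate u) * s)))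

theorem measurableSet_forall_le {V Ω : Type*} {Z : V → Ω → ℝ} (U : Finset V)
    {m : MeasurableSpace Ω} {g : Ω → ℝ} (hg : Measurable g) (h : ∀ u ∈ U, Measurable (Z u)) :
    MeasurableSet {ω | ∀ u ∈ U, g ω ≤ Z u ω} := by
  have : {ω | ∀ u ∈ U, g ω ≤ Z u ω} = ⋂ u ∈ U, {ω | g ω ≤ Z u ω} := by ext; simp
  rw [this]
  exact U.measurableSet_biInter fun u hu => measurableSet_le hg (h u hu)

section
variable {V Ω : Type*} [MeasurableSpace Ω] {rate : V → ℝ} {Z : V → Ω → ℝ} {P : Measure Ω}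

theorem ExpClocks.clockAlg_le (hZ : ExpClocks rate Z P) (U : Set V) :
    clockAlg Z U ≤ ‹MeasurableSpace Ω› :=
  iSup₂_le fun u _ => measurable_iff_comap_le.1 (hZ.measurable u)

theorem ExpClocks.indep_clockAlg (hZ : ExpClocks rate Z P) {U W : Set V} (h : Disjoint U W) :
    Indep (clockAlg Z U) (clockAlg Z W) P :=
  indep_iSup_of_disjoint (fun u => measurable_iff_comap_le.1 (hZ.measurable u)) hZ.indep h

theorem ExpClocks.measure_le (hZ : ExpClocks rate Z P) {v : V} (hv : 0 < rate v) {s : ℝ}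
    (hs : 0 ≤ s) : P {ω | s ≤ Z v ω} = ENNReal.ofReal (Real.exp (-(rate v * s))) := by
  rw [(hZ.law v hv).measure_eq (p := fun q => s ≤ q) measurableSet_Ici]
  exact expMeasure_Ici hv hs

theorem ExpClocks.ae_nonneg [IsProbabilityMeasure P] (hZ : ExpClocks rate Z P) {v : V}
    (hv : 0 < rate v) : ∀ᵐ ω ∂P, 0 ≤ Z v ω := by
  have h := hZ.measure_le hv le_rfl
  simp only [mul_zero, neg_zero, Real.exp_zero, ENNReal.ofReal_one] at h
  exact (prob_compl_eq_zero_iff (measurableSet_le measurable_const (hZ.measurable v))).2 h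

/-- One atomless law suffices by Fubini, so the law of `Z u` may be arbitrary. -/
theorem ExpClocks.ae_ne [IsProbabilityMeasure P] (hZ : ExpClocks rate Z P) {u v : V}
    (huv : u ≠ v) (hv : 0 < rate v) : ∀ᵐ ω ∂P, Z u ω ≠ Z v ω := by
  have hind := hZ.indep.indepFun huv
  have hm := (indepFun_iff_map_prod_eq_prod_map_map (hZ.measurable u).aemeasurable
    (hZ.measurable v).aemeasurable).1 hind
  have hS : MeasurableSet {p : ℝ × ℝ | p.1 = p.2} :=
    measurableSet_eq_fun measurable_fst measurable_snd
  have : P.map (fun ω => (Z u ω, Z v ω)) {p : ℝ × ℝ | p.1 = p.2} = 0 := by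
    have := Measure.isProbabilityMeasure_map (μ := P) (hZ.measurable v).aemeasurable
    rw [hm, Measure.prod_apply hS, lintegral_eq_zero_of_ae_eq_zero]
    refine Filter.Eventually.of_forall fun q => ?_
    have : (Prod.mk q ⁻¹' {p : ℝ × ℝ | p.1 = p.2}) = {q} := by ext z; simp [eq_comm]
    simp [this, (hZ.law v hv).map_eq]
  rw [Measure.map_apply ((hZ.measurable u).prodMk (hZ.measurable v)) hS] at this
  rw [ae_iff]; simpa using this

theorem ChainBound.empty [IsProbabilityMeasure P] :
    ChainBound rate Z P ∅ Set.univ 1 where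
  measurableSet := MeasurableSet.univ
  pos := by simp
  nonneg := zero_le_one
  bound s _ := by simp

/-- By independence the new clock contributes `exp (-(rate v * s))`, exactly the factor by which the
bound shrinks. -/
theorem ChainBound.insert_clock [DecidableEq V] (hZ : ExpClocks rate Z P) {U : Finset V} {X : Set Ω}
    {c : ℝ} (h : ChainBound rate Z P U X c) {v : V} (hv : v ∉ U) (hpos : 0 < rate v) :
    ChainBound rate Z P (insert v U) X c where
  measurableSet := clockAlg_mono Z (by simp) _ h.measurableSet
  pos := by simpa [hpos] using h.pos
  nonneg := h.nonneg
  bound s hs := by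
    have hset : X ∩ {ω | ∀ u ∈ insert v U, s ≤ Z u ω} =
        (X ∩ {ω | ∀ u ∈ U, s ≤ Z u ω}) ∩ {ω | s ≤ Z v ω} := by
      ext ω; simp; tauto
    have hind : Indep (clockAlg Z (U : Set V)) (clockAlg Z {v}) P :=
      hZ.indep_clockAlg (by simpa using hv)
    rw [hset, (Indep_iff _ _ _).1 hind _ _ ?_ ?_]
    · rw [hZ.measure_le hpos hs, Finset.sum_insert hv]
      refine (mul_le_mul_left (h.bound s hs) _).trans_eq ?_
      rw [← ENNReal.ofReal_mul (mul_nonneg h.nonneg (Real.exp_pos _).le), mul_assoc,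
        ← Real.exp_add]
      congr 3; ring
    · exact @MeasurableSet.inter _ (clockAlg Z (U : Set V)) _ _ h.measurableSet
        (measurableSet_forall_le (m := clockAlg Z (U : Set V)) U measurable_const
          fun u hu => measurable_clockAlg Z hu)
    · exact (measurable_clockAlg Z (U := {v}) rfl) measurableSet_Ici

theorem ChainBound.union [DecidableEq V] (hZ : ExpClocks rate Z P) {U : Finset V} {X : Set Ω}
    {c : ℝ} (h : ChainBound rate Z P U X c) (A : Finset V) (hpos : ∀ u ∈ A, 0 < rate u) :
    ChainBound rate Z P (U ∪ A) X c := by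
  induction A using Finset.induction_on with
  | empty => simpa using h
  | insert v A _ ih =>
    have ih := ih fun u hu => hpos u (Finset.mem_insert_of_mem hu)
    rw [Finset.union_insert]
    by_cases hvU : v ∈ U ∪ A
    · rwa [Finset.insert_eq_of_mem hvU]
    · exact ih.insert_clock hZ hvU (hpos v (Finset.mem_insert_self _ _))

/-- Given `Z a = q`, the event needs `X` and all clocks of `U` to be at least `q`, which costs at
most `c * exp (-κ q)` with κ the rate of `U`. Integrating over `q ≥ s` reproduces a bound of the
same form; this is why `ChainBound` is stated for every threshold and not for `X` alone. -/
theorem ChainBound.argmin_insert [DecidableEq V] [IsProbabilityMeasure P]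
    (hZ : ExpClocks rate Z P) {U : Finset V} {X : Set Ω}
    {c : ℝ} (h : ChainBound rate Z P U X c) {a : V} (ha : a ∉ U) (hpos : 0 < rate a) :
    ChainBound rate Z P (insert a U) (X ∩ {ω | ∀ u ∈ insert a U, Z a ω ≤ Z u ω})
      (c * (rate a / ∑ u ∈ insert a U, rate u)) := by
  have hκ : 0 ≤ ∑ u ∈ U, rate u := Finset.sum_nonneg fun u hu => (h.pos u hu).le
  refine ⟨?_, by simpa [hpos] using h.pos, ?_, fun s hs => ?_⟩
  · exact @MeasurableSet.inter _ (clockAlg Z (insert a U : Finset V)) _ _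
      (clockAlg_mono Z (by simp) _ h.measurableSet)
      (measurableSet_forall_le (m := clockAlg Z (insert a U : Finset V)) _
        (measurable_clockAlg Z (by simp)) fun u hu => measurable_clockAlg Z hu)
  · have := h.nonneg
    rw [Finset.sum_insert ha]; positivity
  classical
  -- One variable independent of `Z a` encodes both `X` and the minimum over `U`: the value `⊥` off
  -- `X` makes `q ≤ g ω` force `ω ∈ X`, and `⊤` is the minimum over an empty `U`.
  let g : Ω → EReal := fun ω => if ω ∈ X then U.inf fun u => (Z u ω : EReal) else ⊥
  have hgm : Measurable[clockAlg Z (U : Set V)] g := by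
    refine Measurable.ite h.measurableSet ?_ measurable_const
    have : ∀ W ⊆ U, Measurable[clockAlg Z (U : Set V)]
        fun ω => W.inf fun u => (Z u ω : EReal) := by
      intro W
      induction W using Finset.induction_on with
      | empty => intro _; exact measurable_const
      | insert v W _ ih =>
        intro hW
        simp only [Finset.inf_insert]
        exact @Measurable.inf _ _ _ (clockAlg Z (U : Set V)) _ _ _ _
          (measurable_coe_real_ereal.comp (measurable_clockAlg Z (hW (by simp))))
          (ih ((Finset.subset_insert _ _).trans hW))
    exact this U subset_rfl
  have hgm' : Measurable g := hgm.mono (hZ.clockAlg_le _) le_rfl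
  have hind : IndepFun (Z a) g P := by
    rw [IndepFun_iff_Indep]
    have hd := hZ.indep_clockAlg (U := {a}) (W := (U : Set V)) (by simpa using ha)
    exact indep_of_indep_of_le_left (indep_of_indep_of_le_right hd
      (measurable_iff_comap_le.1 hgm)) (measurable_iff_comap_le.1 (measurable_clockAlg Z rfl))
  have hm := (indepFun_iff_map_prod_eq_prod_map_map (hZ.measurable a).aemeasurable
    hgm'.aemeasurable).1 hind
  let S : Set (ℝ × EReal) := {p | s ≤ p.1 ∧ (p.1 : EReal) ≤ p.2}
  have hS : MeasurableSet S := by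
    refine MeasurableSet.inter (measurableSet_le measurable_const measurable_fst)
      (measurableSet_le (measurable_coe_real_ereal.comp measurable_fst) measurable_snd)
  have hset : (X ∩ {ω | ∀ u ∈ insert a U, Z a ω ≤ Z u ω}) ∩
      {ω | ∀ u ∈ insert a U, s ≤ Z u ω} ⊆ (fun ω => (Z a ω, g ω)) ⁻¹' S := by
    rintro ω ⟨⟨hX, h1⟩, h2⟩
    refine ⟨h2 a (by simp), ?_⟩
    simp only [g, if_pos hX, Finset.le_inf_iff, EReal.coe_le_coe_iff]
    exact fun u hu => h1 u (by simp [hu])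
  refine (measure_mono hset).trans ?_
  have := Measure.isProbabilityMeasure_map (μ := P) hgm'.aemeasurable
  rw [← Measure.map_apply ((hZ.measurable a).prodMk hgm') hS, hm, Measure.prod_apply hS,
    (hZ.law a hpos).map_eq]
  have hle : ∀ q, P.map g (Prod.mk q ⁻¹' S) ≤
      (Set.Ici s).indicator (fun q => ENNReal.ofReal c *
        ENNReal.ofReal (Real.exp (-((∑ u ∈ U, rate u) * q)))) q := by
    intro q
    rw [Measure.map_apply hgm' (measurable_prodMk_left hS)]
    by_cases hq : s ≤ q
    · rw [Set.indicator_of_mem (show q ∈ Set.Ici s from hq), ← ENNReal.ofReal_mul h.nonneg]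
      refine (measure_mono ?_).trans (h.bound q (hs.trans hq))
      rintro ω ⟨-, h2⟩
      by_cases hX : ω ∈ X
      · refine ⟨hX, ?_⟩
        simpa [g, if_pos hX, Finset.le_inf_iff, EReal.coe_le_coe_iff] using h2
      · simp [g, hX] at h2
    · have : g ⁻¹' (Prod.mk q ⁻¹' S) = ∅ := by
        ext ω; simp [S, hq]
      simp [this]
  refine (lintegral_mono hle).trans_eq ?_
  rw [lintegral_indicator measurableSet_Ici, lintegral_const_mul _ (by fun_prop),
    lintegral_expMeasure_tail hpos hκ hs, ← ENNReal.ofReal_mul h.nonneg, Finset.sum_insert ha,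
    mul_assoc]

/-- Extending a chain of nested argmin events by one step. -/
theorem ChainBound.argmin [DecidableEq V] [IsProbabilityMeasure P]
    (hZ : ExpClocks rate Z P) {U A : Finset V} {X : Set Ω}
    {c : ℝ} (h : ChainBound rate Z P U X c) {a : V} (ha : a ∉ U) (haA : a ∈ A)
    (hpos : ∀ u ∈ A, 0 < rate u) :
    ChainBound rate Z P (A ∪ U) (X ∩ {ω | ∀ u ∈ A ∪ U, Z a ω ≤ Z u ω})
      (c * (rate a / ∑ u ∈ A ∪ U, rate u)) := by
  -- The other new competitors enter first; `a` is kept out so that it is still independent of them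
  -- when it is compared.
  have h1 := (h.union hZ (A.erase a) fun u hu => hpos u (Finset.mem_of_mem_erase hu)).argmin_insert
    hZ (a := a) (by simp [ha]) (hpos a haA)
  have : insert a (U ∪ A.erase a) = A ∪ U := by
    ext u; by_cases hu : u = a <;> simp [hu, haA, or_comm]
  rwa [this] at h1

theorem ChainBound.measure_le [IsProbabilityMeasure P]
    (hZ : ExpClocks rate Z P) {U : Finset V} {X : Set Ω}
    {c : ℝ} (h : ChainBound rate Z P U X c) : P.real X ≤ c := by
  have hae : ∀ᵐ ω ∂P, ∀ u ∈ U, 0 ≤ Z u ω :=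
    (Finset.eventually_all U).2 fun u hu => hZ.ae_nonneg (h.pos u hu)
  -- At threshold 0 the condition on the clocks holds almost surely.
  have h0 := h.bound 0 le_rfl
  rw [measure_inter_conull hae] at h0
  simpa [Measure.real] using ENNReal.toReal_le_of_le_ofReal h.nonneg (by simpa using h0)

theorem ChainBound.inter_le [IsProbabilityMeasure P]
    (hZ : ExpClocks rate Z P) {U W : Finset V} {X Y : Set Ω} {b c : ℝ}
    (h : ChainBound rate Z P U X b) (h' : ChainBound rate Z P W Y c) (hd : Disjoint U W) :
    P.real (X ∩ Y) ≤ b * c := by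
  have hind := hZ.indep_clockAlg (U := (U : Set V)) (W := (W : Set V)) (by exact_mod_cast hd)
  rw [Measure.real, (Indep_iff _ _ _).1 hind _ _ h.measurableSet h'.measurableSet,
    ENNReal.toReal_mul]
  exact mul_le_mul (h.measure_le hZ) (h'.measure_le hZ) measureReal_nonneg h.nonneg

end
-- Weights of chains and their geometric decay
section
set_option linter.unusedSectionVars false
variable {F C : Type*} [Fintype F] [Fintype C]

open Classical in
/-- The facilities that client `j` is adjacent to. -/
noncomputable def facNbrs (x : F → C → ℝ) (j : C) : Finset F := {i | 0 < x i j}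

open Classical in
/-- The clients that facility `i` is adjacent to. -/
noncomputable def cliNbrs (x : F → C → ℝ) (i : F) : Finset C := {j | 0 < x i j}

theorem mem_facNbrs {x : F → C → ℝ} {i : F} {j : C} : i ∈ facNbrs x j ↔ 0 < x i j := by
  simp [facNbrs]

theorem mem_cliNbrs {x : F → C → ℝ} {i : F} {j : C} : j ∈ cliNbrs x i ↔ 0 < x i j := by
  simp [cliNbrs]

/-- All facilities adjacent to a client of the chain `l`. -/
noncomputable def chainFacs (x : F → C → ℝ) (l : List (F × C)) : Finset F :=
  open Classical in l.foldr (fun p s => facNbrs x p.2 ∪ s) ∅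

/-- All clients adjacent to a facility of the chain `l`. -/
noncomputable def chainClis (x : F → C → ℝ) (l : List (F × C)) : Finset C :=
  open Classical in l.foldr (fun p s => cliNbrs x p.1 ∪ s) ∅

open Classical in
theorem chainFacs_cons (x : F → C → ℝ) (p : F × C) (l : List (F × C)) :
    chainFacs x (p :: l) = facNbrs x p.2 ∪ chainFacs x l := rfl

open Classical in
theorem chainClis_cons (x : F → C → ℝ) (p : F × C) (l : List (F × C)) :
    chainClis x (p :: l) = cliNbrs x p.1 ∪ chainClis x l := rfl

theorem mem_chainFacs {x : F → C → ℝ} {l : List (F × C)} {i : F} :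
    i ∈ chainFacs x l ↔ ∃ p ∈ l, 0 < x i p.2 := by
  induction l with
  | nil => simp [chainFacs]
  | cons p l ih => simp [chainFacs_cons, ih, mem_facNbrs]

theorem mem_chainClis {x : F → C → ℝ} {l : List (F × C)} {j : C} :
    j ∈ chainClis x l ↔ ∃ p ∈ l, 0 < x p.1 j := by
  induction l with
  | nil => simp [chainClis]
  | cons p l ih => simp [chainClis_cons, ih, mem_cliNbrs]

/-- Lists `[(iₖ, jₖ), …, (i₁, j₁)]` that may be traversed, in reverse order and with distinct
clocks, as the beginning `j₁, i₁, …, jₖ, iₖ, j` of a connection path. -/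
def Admissible (x : F → C → ℝ) : C → List (F × C) → Prop
  | _, [] => True
  | j, p :: l => 0 < x p.1 j ∧ 0 < x p.1 p.2 ∧ p.1 ∉ chainFacs x l ∧ j ∉ chainClis x l ∧
      Admissible x p.2 l

open Classical in
/-- Bound on the probability that the facility clocks are compatible with the chain `l`. -/
noncomputable def facWeight (x : F → C → ℝ) (o : F → ℝ) : List (F × C) → ℝ
  | [] => 1
  | p :: l => facWeight x o l * (o p.1 / ∑ i ∈ facNbrs x p.2 ∪ chainFacs x l, o i)

open Classical in
/-- Bound on the probability that the client clocks are compatible with the chain `l`. -/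
noncomputable def cliWeight (x : F → C → ℝ) : List (F × C) → ℝ
  | [] => 1
  | p :: l => cliWeight x l * (1 / ((cliNbrs x p.1 ∪ chainClis x l).card : ℝ))

/-- The lists of length `k`. -/
def chains (F C : Type*) [Fintype F] [Fintype C] : ℕ → Finset (List (F × C))
  | 0 => {[]}
  | k + 1 => ((Finset.univ : Finset (F × C)) ×ˢ chains F C k).map
      ⟨fun q => q.1 :: q.2, fun a b h => by
        simp only [List.cons.injEq] at h; exact Prod.ext h.1 h.2⟩

theorem mem_chains {k : ℕ} {l : List (F × C)} : l ∈ chains F C k ↔ l.length = k := by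
  induction k generalizing l with
  | zero => simp [chains]
  | succ k ih =>
    cases l with
    | nil => simp [chains]
    | cons p l =>
      simp only [chains, Finset.mem_map, Finset.mem_product, Finset.mem_univ, true_and, ih,
        List.length_cons, Nat.add_right_cancel_iff]
      constructor
      · rintro ⟨q, hq, h⟩
        obtain ⟨-, rfl⟩ := List.cons.inj h
        exact hq
      · exact fun h => ⟨(p, l), h, rfl⟩

theorem sum_chains_succ (k : ℕ) (g : List (F × C) → ℝ) :
    ∑ l ∈ chains F C (k + 1), g l = ∑ i, ∑ j, ∑ l ∈ chains F C k, g ((i, j) :: l) := by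
  simp only [chains, Finset.sum_map, Finset.sum_product, Fintype.sum_prod_type]
  rfl

/-- Fractional solutions whose support is weighted by the opening rates. -/
structure Weighted (x : F → C → ℝ) (o : F → ℝ) : Prop where
  nonneg : ∀ i j, 0 ≤ x i j
  eq_rate : ∀ i j, 0 < x i j → x i j = o i
  rate_nonneg : ∀ i, 0 ≤ o i
  sum_eq_one : ∀ j, ∑ i, x i j = 1

variable {x : F → C → ℝ} {o : F → ℝ}

theorem Weighted.rate_pos (h : Weighted x o) {i : F} {j : C} (hx : 0 < x i j) : 0 < o i :=
  h.eq_rate i j hx ▸ hx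

theorem Weighted.sum_facNbrs (h : Weighted x o) (j : C) : ∑ i ∈ facNbrs x j, o i = 1 := by
  rw [← h.sum_eq_one j, facNbrs, Finset.sum_filter]
  refine Finset.sum_congr rfl fun i _ => ?_
  split_ifs with hx
  · exact (h.eq_rate i j hx).symm
  · exact le_antisymm (h.nonneg i j) (not_lt.1 hx)

theorem Weighted.one_le_sum (h : Weighted x o) (j : C) {s : Finset F} (hs : facNbrs x j ⊆ s) :
    1 ≤ ∑ i ∈ s, o i := by
  rw [← h.sum_facNbrs j]
  exact Finset.sum_le_sum_of_subset_of_nonneg hs fun i _ _ => h.rate_nonneg i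

theorem facWeight_nonneg (h : Weighted x o) (l : List (F × C)) : 0 ≤ facWeight x o l := by
  induction l with
  | nil => simp [facWeight]
  | cons p l ih =>
    exact mul_nonneg ih (div_nonneg (h.rate_nonneg _) (Finset.sum_nonneg fun i _ => h.rate_nonneg i))

theorem cliWeight_nonneg (x : F → C → ℝ) (l : List (F × C)) : 0 ≤ cliWeight x l := by
  induction l with
  | nil => simp [cliWeight]
  | cons p l ih => exact mul_nonneg ih (by positivity)

/-- An average is at most a common upper bound; `0 ≤ a` covers an empty neighbourhood. -/
theorem sum_cliNbrs_le (x : F → C → ℝ) (i : F) {g : C → ℝ} {a : ℝ} (ha : 0 ≤ a)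
    (hg : ∀ j, g j ≤ a) : ∑ j ∈ cliNbrs x i, 1 / ((cliNbrs x i).card : ℝ) * g j ≤ a := by
  rw [← Finset.mul_sum]
  have h1 : ∑ j ∈ cliNbrs x i, g j ≤ (cliNbrs x i).card * a := by
    simpa using Finset.sum_le_card_nsmul _ _ _ fun j _ => hg j
  calc _ ≤ 1 / ((cliNbrs x i).card : ℝ) * ((cliNbrs x i).card * a) := by gcongr
    _ ≤ a := by
      rcases eq_or_ne ((cliNbrs x i).card : ℝ) 0 with h0 | h0
      · simp [h0, ha]
      · field_simp; exact le_rfl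

/-- Earlier clients are dropped from the competition: no decay is needed on the client side, only a
uniform average over the neighbours of the facility. -/
theorem cliWeight_cons_le (x : F → C → ℝ) {p : F × C} {l : List (F × C)} (hp : 0 < x p.1 p.2) :
    cliWeight x (p :: l) ≤ cliWeight x l * (1 / ((cliNbrs x p.1).card : ℝ)) := by
  classical
  have h0 : 0 < (cliNbrs x p.1).card := Finset.card_pos.2 ⟨p.2, mem_cliNbrs.2 hp⟩
  refine mul_le_mul_of_nonneg_left ?_ (cliWeight_nonneg x l)
  refine one_div_le_one_div_of_le (by exact_mod_cast h0) ?_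
  exact_mod_cast Finset.card_le_card (by rw [Finset.subset_iff]; simp +contextual)

open Classical in
/-- The weight of a chain that has reached `j` and whose next facility is about to be chosen,
normalized by the rate of that facility. -/
noncomputable def endWeight (x : F → C → ℝ) (o : F → ℝ) (j : C) (l : List (F × C)) : ℝ :=
  facWeight x o l * cliWeight x l / ∑ i ∈ facNbrs x j ∪ chainFacs x l, o i

theorem endWeight_nonneg (h : Weighted x o) (j : C) (l : List (F × C)) :
    0 ≤ endWeight x o j l :=
  div_nonneg (mul_nonneg (facWeight_nonneg h l) (cliWeight_nonneg x l))
    (Finset.sum_nonneg fun i _ => h.rate_nonneg i)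

theorem facWeight_mul_cliWeight_cons_le (h : Weighted x o) {p : F × C} {l : List (F × C)}
    (hp : 0 < x p.1 p.2) :
    facWeight x o (p :: l) * cliWeight x (p :: l) ≤
      o p.1 * (1 / ((cliNbrs x p.1).card : ℝ) * endWeight x o p.2 l) := by
  refine (mul_le_mul_of_nonneg_left (cliWeight_cons_le x hp) (facWeight_nonneg h _)).trans_eq ?_
  rw [facWeight, endWeight]; ring

open Classical in
-- With a the rate of `N(j) \ N(j')`, the sum is a/(1 + a), and a ≤ 1 because each client's
-- neighbourhood has rate 1. This is the source of the geometric decay.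
theorem sum_union_half (h : Weighted x o) (j j' : C) :
    ∑ i ∈ facNbrs x j with i ∉ facNbrs x j', o i / ∑ i ∈ facNbrs x j' ∪ facNbrs x j, o i ≤
      1 / 2 := by
  rw [← Finset.sum_div]
  have h1 : ∑ i ∈ facNbrs x j' ∪ facNbrs x j, o i =
      1 + ∑ i ∈ facNbrs x j with i ∉ facNbrs x j', o i := by
    rw [← h.sum_facNbrs j', ← Finset.sum_union]
    · refine Finset.sum_congr ?_ fun _ _ => rfl
      ext i; simp; tauto
    · rw [Finset.disjoint_left]; simp +contextual
  have h2 : ∑ i ∈ facNbrs x j with i ∉ facNbrs x j', o i ≤ 1 := by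
    rw [← h.sum_facNbrs j]
    exact Finset.sum_le_sum_of_subset_of_nonneg (Finset.filter_subset _ _)
      fun i _ _ => h.rate_nonneg i
  have h3 : 0 ≤ ∑ i ∈ facNbrs x j with i ∉ facNbrs x j', o i :=
    Finset.sum_nonneg fun i _ => h.rate_nonneg i
  rw [h1, div_le_div_iff₀ (by linarith) (by norm_num)]
  linarith

open Classical in
-- Here `j'` is the client two arcs after `j`, and the divisor bounds from below the rate of the
-- competition at `j'`. Peeling off the facility `i` entering `j` gives `sum_union_half`, since `i`
-- is not adjacent to `j'`; the divisor left over from `endWeight` at `j` serves the induction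
-- hypothesis for the pair `(j₂, j)`.
theorem sum_endWeight_div_le (h : Weighted x o) (k : ℕ) (j j' : C) :
    ∑ l ∈ chains F C k with Admissible x j l ∧ j' ∉ chainClis x l,
      endWeight x o j l / ∑ i ∈ facNbrs x j' ∪ facNbrs x j, o i ≤ (1 / 2) ^ k := by
  induction k generalizing j j' with
  | zero =>
    have h1 := h.one_le_sum j (s := facNbrs x j ∪ ∅) (by simp)
    have h2 := h.one_le_sum j (s := facNbrs x j' ∪ facNbrs x j) Finset.subset_union_right
    simp only [chains, Finset.sum_filter, Finset.sum_singleton, pow_zero]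
    split_ifs
    · rw [endWeight]
      refine div_le_one_of_le₀ (le_trans ?_ h2) (by linarith)
      simp only [facWeight, cliWeight, mul_one]
      exact div_le_one_of_le₀ h1 (zero_le_one.trans h1)
    · exact zero_le_one
  | succ k ih =>
    rw [Finset.sum_filter, sum_chains_succ]
    set S := ∑ i ∈ facNbrs x j' ∪ facNbrs x j, o i with hS
    have hS1 : 1 ≤ S := h.one_le_sum j Finset.subset_union_right
    calc _ ≤ ∑ i, ∑ j₂, if i ∈ facNbrs x j ∧ i ∉ facNbrs x j' ∧ j₂ ∈ cliNbrs x i then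
          o i / S * (1 / ((cliNbrs x i).card : ℝ) *
            ∑ l ∈ chains F C k with Admissible x j₂ l ∧ j ∉ chainClis x l,
              endWeight x o j₂ l / ∑ i ∈ facNbrs x j ∪ facNbrs x j₂, o i) else 0 := by
          refine Finset.sum_le_sum fun i _ => Finset.sum_le_sum fun j₂ _ => ?_
          split_ifs with hi
          · rw [Finset.mul_sum, Finset.mul_sum, Finset.sum_filter]
            refine Finset.sum_le_sum fun l _ => ?_
            -- Only the two latest clients are kept in the denominator, which matches the induction
            -- hypothesis.
            have hsub : ∑ i ∈ facNbrs x j ∪ facNbrs x j₂, o i ≤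
                ∑ i ∈ facNbrs x j ∪ chainFacs x ((i, j₂) :: l), o i := by
              refine Finset.sum_le_sum_of_subset_of_nonneg ?_ fun i _ _ => h.rate_nonneg i
              rw [chainFacs_cons]
              exact Finset.union_subset_union_right Finset.subset_union_left
            have h1 := h.one_le_sum j (s := facNbrs x j ∪ facNbrs x j₂) Finset.subset_union_left
            have hp : 0 < x i j₂ := mem_cliNbrs.1 hi.2.2
            have hE := endWeight_nonneg h j₂ l
            have hoi := h.rate_nonneg i
            split_ifs with hA hB hB
            · have hw := facWeight_mul_cliWeight_cons_le h (p := (i, j₂)) (l := l) hp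
              calc endWeight x o j ((i, j₂) :: l) / S
                  ≤ (o i * (1 / ((cliNbrs x i).card : ℝ) * endWeight x o j₂ l)) /
                    (∑ i ∈ facNbrs x j ∪ facNbrs x j₂, o i) / S := by
                    refine div_le_div_of_nonneg_right ?_ (by linarith)
                    exact div_le_div₀ (by positivity) hw (by linarith) hsub
                _ = _ := by ring
            · exact absurd ⟨hA.1.2.2.2.2, hA.1.2.2.2.1⟩ hB
            · positivity
            · exact le_rfl
          · refine Finset.sum_nonpos fun l _ => ?_
            rw [if_neg]
            rintro ⟨⟨h1, h2, -⟩, h3⟩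
            refine hi ⟨mem_facNbrs.2 h1, fun h4 => h3 ?_, mem_cliNbrs.2 h2⟩
            exact mem_chainClis.2 ⟨(i, j₂), by simp, mem_facNbrs.1 h4⟩
      _ = ∑ i ∈ facNbrs x j with i ∉ facNbrs x j', o i / S * ∑ j₂ ∈ cliNbrs x i,
            (1 / ((cliNbrs x i).card : ℝ) *
            ∑ l ∈ chains F C k with Admissible x j₂ l ∧ j ∉ chainClis x l,
              endWeight x o j₂ l / ∑ i ∈ facNbrs x j ∪ facNbrs x j₂, o i) := by
          have : (facNbrs x j).filter (fun i => i ∉ facNbrs x j') =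
              Finset.univ.filter fun i => i ∈ facNbrs x j ∧ i ∉ facNbrs x j' := by ext; simp
          rw [this, Finset.sum_filter]
          refine Finset.sum_congr rfl fun i _ => ?_
          rw [Finset.mul_sum, ← Finset.sum_filter]
          split_ifs with hi
          · refine Finset.sum_congr ?_ fun _ _ => rfl
            ext; simp [hi]
          · rw [Finset.filter_false_of_mem, Finset.sum_empty]
            exact fun _ _ h => hi ⟨h.1, h.2.1⟩
      _ ≤ ∑ i ∈ facNbrs x j with i ∉ facNbrs x j', o i / S * (1 / 2) ^ k := by
          refine Finset.sum_le_sum fun i _ => ?_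
          refine mul_le_mul_of_nonneg_left ?_ (div_nonneg (h.rate_nonneg i) (by linarith))
          exact sum_cliNbrs_le x i (by positivity) fun j₂ => ih j₂ j
      _ ≤ (1 / 2) ^ (k + 1) := by
          rw [← Finset.sum_mul, pow_succ']
          exact mul_le_mul_of_nonneg_right (sum_union_half h j j') (by positivity)

/-- The sequence `1, 1, 1/2, 1/4, …`. -/
noncomputable def geo : ℕ → ℝ
  | 0 => 1
  | k + 1 => (1 / 2) ^ k

theorem geo_nonneg (k : ℕ) : 0 ≤ geo k := by
  cases k <;> simp [geo]

/-- 1 + (1 + 1/2 + 1/4 + …) = 3. -/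
theorem sum_geo_le (n : ℕ) : ∑ k ∈ Finset.range n, geo k ≤ 3 := by
  cases n with
  | zero => simp
  | succ n =>
    rw [Finset.sum_range_succ']
    simp only [geo]
    rw [geom_sum_eq (by norm_num)]
    have : (0 : ℝ) ≤ (1 / 2) ^ n := by positivity
    rw [div_add_one (by norm_num), div_le_iff_of_neg (by norm_num)]
    linarith

open Classical in
-- With no later client to avoid, the facility entering `j` ranges over all of `N(j)`, of rate 1,
-- and gains no factor 1/2. Hence `geo` begins with 1 twice.
theorem sum_endWeight_le (h : Weighted x o) (k : ℕ) (j : C) :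
    ∑ l ∈ chains F C k with Admissible x j l, endWeight x o j l ≤ geo k := by
  cases k with
  | zero =>
    have h1 := h.one_le_sum j (s := facNbrs x j ∪ ∅) (by simp)
    simp only [chains, Finset.sum_filter, Finset.sum_singleton, geo]
    split_ifs
    · rw [endWeight]
      simp only [facWeight, cliWeight, mul_one]
      exact div_le_one_of_le₀ h1 (zero_le_one.trans h1)
    · exact zero_le_one
  | succ k =>
    rw [Finset.sum_filter, sum_chains_succ]
    calc _ ≤ ∑ i, ∑ j₂, if i ∈ facNbrs x j ∧ j₂ ∈ cliNbrs x i then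
          o i * (1 / ((cliNbrs x i).card : ℝ) *
            ∑ l ∈ chains F C k with Admissible x j₂ l ∧ j ∉ chainClis x l,
              endWeight x o j₂ l / ∑ i ∈ facNbrs x j ∪ facNbrs x j₂, o i) else 0 := by
          refine Finset.sum_le_sum fun i _ => Finset.sum_le_sum fun j₂ _ => ?_
          split_ifs with hi
          · rw [Finset.mul_sum, Finset.mul_sum, Finset.sum_filter]
            refine Finset.sum_le_sum fun l _ => ?_
            have hsub : ∑ i ∈ facNbrs x j ∪ facNbrs x j₂, o i ≤
                ∑ i ∈ facNbrs x j ∪ chainFacs x ((i, j₂) :: l), o i := by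
              refine Finset.sum_le_sum_of_subset_of_nonneg ?_ fun i _ _ => h.rate_nonneg i
              rw [chainFacs_cons]
              exact Finset.union_subset_union_right Finset.subset_union_left
            have h1 := h.one_le_sum j (s := facNbrs x j ∪ facNbrs x j₂) Finset.subset_union_left
            have hp : 0 < x i j₂ := mem_cliNbrs.1 hi.2
            have hE := endWeight_nonneg h j₂ l
            have hoi := h.rate_nonneg i
            split_ifs with hA hB hB
            · have hw := facWeight_mul_cliWeight_cons_le h (p := (i, j₂)) (l := l) hp
              calc endWeight x o j ((i, j₂) :: l)
                  ≤ (o i * (1 / ((cliNbrs x i).card : ℝ) * endWeight x o j₂ l)) /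
                    (∑ i ∈ facNbrs x j ∪ facNbrs x j₂, o i) :=
                    div_le_div₀ (by positivity) hw (by linarith) hsub
                _ = _ := by ring
            · exact absurd ⟨hA.2.2.2.2, hA.2.2.2.1⟩ hB
            · positivity
            · exact le_rfl
          · refine Finset.sum_nonpos fun l _ => ?_
            rw [if_neg]
            rintro ⟨h1, h2, -⟩
            exact hi ⟨mem_facNbrs.2 h1, mem_cliNbrs.2 h2⟩
      _ = ∑ i ∈ facNbrs x j, o i * ∑ j₂ ∈ cliNbrs x i,
            (1 / ((cliNbrs x i).card : ℝ) *
            ∑ l ∈ chains F C k with Admissible x j₂ l ∧ j ∉ chainClis x l,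
              endWeight x o j₂ l / ∑ i ∈ facNbrs x j ∪ facNbrs x j₂, o i) := by
          have : facNbrs x j = Finset.univ.filter fun i => i ∈ facNbrs x j := by ext; simp
          rw [Finset.sum_congr this fun _ _ => rfl, Finset.sum_filter]
          refine Finset.sum_congr rfl fun i _ => ?_
          rw [Finset.mul_sum, ← Finset.sum_filter]
          split_ifs with hi
          · refine Finset.sum_congr ?_ fun _ _ => rfl
            ext; simp [hi]
          · rw [Finset.filter_false_of_mem, Finset.sum_empty]
            exact fun _ _ h => hi h.1
      _ ≤ ∑ i ∈ facNbrs x j, o i * (1 / 2) ^ k := by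
          refine Finset.sum_le_sum fun i _ => ?_
          refine mul_le_mul_of_nonneg_left ?_ (h.rate_nonneg i)
          exact sum_cliNbrs_le x i (by positivity) fun j₂ => sum_endWeight_div_le h k j₂ j
      _ = geo (k + 1) := by
          rw [← Finset.sum_mul, h.sum_facNbrs, one_mul, geo]

open Classical in
theorem sum_chains_succ_le (h : Weighted x o) (k : ℕ) (i : F) (j : C) :
    ∑ j₂, ∑ l ∈ chains F C k with Admissible x j ((i, j₂) :: l),
      facWeight x o ((i, j₂) :: l) * cliWeight x ((i, j₂) :: l) ≤ o i * geo k := by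
  calc _ ≤ ∑ j₂, if j₂ ∈ cliNbrs x i then o i * (1 / ((cliNbrs x i).card : ℝ) *
        ∑ l ∈ chains F C k with Admissible x j₂ l, endWeight x o j₂ l) else 0 := by
        refine Finset.sum_le_sum fun j₂ _ => ?_
        split_ifs with hi
        · rw [Finset.mul_sum, Finset.mul_sum, Finset.sum_filter, Finset.sum_filter]
          refine Finset.sum_le_sum fun l _ => ?_
          have hE := endWeight_nonneg h j₂ l
          have hoi := h.rate_nonneg i
          split_ifs with hA hB hB
          · exact facWeight_mul_cliWeight_cons_le h (p := (i, j₂)) (l := l) hA.2.1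
          · exact absurd hA.2.2.2.2 hB
          · positivity
          · exact le_rfl
        · refine (Finset.sum_eq_zero fun l hl => ?_).le
          exact absurd (mem_cliNbrs.2 (Finset.mem_filter.1 hl).2.2.1) hi
    _ = o i * ∑ j₂ ∈ cliNbrs x i, (1 / ((cliNbrs x i).card : ℝ) *
        ∑ l ∈ chains F C k with Admissible x j₂ l, endWeight x o j₂ l) := by
        rw [← Finset.sum_filter, Finset.mul_sum]
        refine Finset.sum_congr ?_ fun _ _ => rfl
        ext; simp
    _ ≤ o i * geo k :=
        mul_le_mul_of_nonneg_left (sum_cliNbrs_le x i (geo_nonneg k) fun j₂ =>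
          sum_endWeight_le h k j₂) (h.rate_nonneg i)

end
-- Clock monotonicity along a path
section Graph
variable {V : Type*} {G : SimpleGraph V} {clock : V → ℝ}

theorem isSmallestNbr_arcHead_of_ne {v : V} (h : arcHead G clock v ≠ v) :
    IsSmallestNbr G clock v (arcHead G clock v) := by
  unfold arcHead at h ⊢
  split_ifs at h ⊢ with hw
  · exact hw.choose_spec
  · exact absurd rfl h

theorem isSmallestNbr_arcHead_of_adj [Finite V] {v u : V} (h : G.Adj v u) :
    IsSmallestNbr G clock v (arcHead G clock v) := by
  have hw : ∃ w, IsSmallestNbr G clock v w :=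
    Set.exists_min_image {w | G.Adj v w} clock (Set.toFinite _) ⟨u, h⟩
  unfold arcHead
  rw [dif_pos hw]
  exact hw.choose_spec

open Classical in
-- The choice is made from the predicate alone, so equal sets of smallest neighbours also have their
-- ties broken equally.
theorem arcHead_congr {G' : SimpleGraph V} {clock' : V → ℝ} {v : V}
    (h : ∀ w, IsSmallestNbr G clock v w ↔ IsSmallestNbr G' clock' v w) :
    arcHead G clock v = arcHead G' clock' v := by
  have e : IsSmallestNbr G clock v = IsSmallestNbr G' clock' v := funext fun w => propext (h w)
  have key (p q : V → Prop) (hpq : p = q) :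
      (if h : ∃ w, p w then h.choose else v) = if h : ∃ w, q w then h.choose else v := by
    subst hpq; rfl
  exact key _ _ e

/-- The first `n` arcs of the path that starts at `v` and follows `s` revisit no vertex. -/
def NoRevisit (s : V → V) (v : V) (n : ℕ) : Prop :=
  ∀ a b, a < b → b ≤ n → s^[a] v ≠ s^[b] v

theorem NoRevisit.mono {s : V → V} {v : V} {m n : ℕ} (h : NoRevisit s v n) (hmn : m ≤ n) :
    NoRevisit s v m := fun a b hab hb => h a b hab (hb.trans hmn)

theorem noRevisit_pathLength (s : V → V) (v : V) : NoRevisit s v (pathLength s v) := by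
  intro a b hab hb h
  obtain ⟨c, rfl⟩ := Nat.exists_eq_add_of_lt hab
  exact Nat.notMem_of_lt_sInf (show a + c < pathLength s v by omega) ⟨a, by omega, h.symm⟩

theorem pathLength_spec [Finite V] (s : V → V) (v : V) :
    ∃ m ≤ pathLength s v, s^[pathLength s v + 1] v = s^[m] v :=
  Nat.sInf_mem (s := {n : ℕ | ∃ m ≤ n, s^[n + 1] v = s^[m] v}) (exists_revisit s v)

/-- A vertex without a smallest neighbour is sent to itself, which would be a revisit. -/
theorem NoRevisit.isSmallestNbr {v : V} {n k : ℕ} (h : NoRevisit (arcHead G clock) v n)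
    (hk : k + 1 ≤ n) :
    IsSmallestNbr G clock ((arcHead G clock)^[k] v) ((arcHead G clock)^[k + 1] v) := by
  have h1 := h k (k + 1) (by omega) hk
  rw [Function.iterate_succ_apply'] at h1 ⊢
  exact isSmallestNbr_arcHead_of_ne h1.symm

/-- A vertex choosing its successor also has its predecessor among its neighbours, so clocks do not
increase over two arcs. -/
theorem NoRevisit.clock_le {v : V} {n k a : ℕ} (h : NoRevisit (arcHead G clock) v n)
    (hk : k + 2 * a ≤ n) :
    clock ((arcHead G clock)^[k + 2 * a] v) ≤ clock ((arcHead G clock)^[k] v) := by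
  induction a with
  | zero => simp
  | succ a ih =>
    refine le_trans ?_ (ih (by omega))
    exact (h.isSmallestNbr (k := k + 2 * a + 1) (by omega)).2 _
      (h.isSmallestNbr (k := k + 2 * a) (by omega)).1.symm

theorem NoRevisit.clock_le_of_adj {v u : V} {n k a : ℕ} (h : NoRevisit (arcHead G clock) v n)
    (hk : k + 1 + 2 * a ≤ n) (hu : G.Adj ((arcHead G clock)^[k] v) u) :
    clock ((arcHead G clock)^[k + 1 + 2 * a] v) ≤ clock u :=
  (h.clock_le hk).trans ((h.isSmallestNbr (by omega)).2 u hu)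

/-- If adjacent, the later vertex would have a clock at least that of the vertex chosen at step `k`,
and by monotonicity at most that; the tie makes them equal, a revisit. -/
theorem NoRevisit.not_adj {v : V} {n k a : ℕ} (h : NoRevisit (arcHead G clock) v n)
    (hties : ∀ u w z, G.Adj w z → clock u = clock w → u = w) (ha : 0 < a)
    (hk : k + 1 + 2 * a ≤ n) :
    ¬ G.Adj ((arcHead G clock)^[k] v) ((arcHead G clock)^[k + 1 + 2 * a] v) := by
  intro hadj
  have h1 := (h.isSmallestNbr (k := k) (by omega)).2 _ hadj
  have h2 := h.clock_le (k := k + 1) hk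
  exact h (k + 1) (k + 1 + 2 * a) (by omega) hk (hties _ _ _ hadj.symm (le_antisymm h1 h2))

end Graph

/-! ### From connection paths to compatible chains -/

section Bipartite
variable {F C : Type*} {x : F → C → ℝ} {clock : F ⊕ C → ℝ}

theorem adj_inl_inr {i : F} {j : C} : (supportGraph x).Adj (.inl i) (.inr j) ↔ 0 < x i j := by
  simp [supportGraph]

theorem adj_inr_inl {i : F} {j : C} : (supportGraph x).Adj (.inr j) (.inl i) ↔ 0 < x i j := by
  simp [supportGraph]

theorem exists_eq_inr_of_adj_inl {i : F} {v : F ⊕ C} (h : (supportGraph x).Adj (.inl i) v) :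
    ∃ j, v = .inr j := by
  rcases v with v | v
  · simp [supportGraph] at h
  · exact ⟨v, rfl⟩

theorem exists_eq_inl_of_adj_inr {j : C} {v : F ⊕ C} (h : (supportGraph x).Adj (.inr j) v) :
    ∃ i, v = .inl i := by
  rcases v with v | v
  · exact ⟨v, rfl⟩
  · simp [supportGraph] at h

theorem NoRevisit.parity {j : C} {n : ℕ}
    (h : NoRevisit (arcHead (supportGraph x) clock) (.inr j) n) (k : ℕ) (hk : 2 * k ≤ n) :
    ∃ j', (arcHead (supportGraph x) clock)^[2 * k] (.inr j) = .inr j' := by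
  induction k with
  | zero => exact ⟨j, rfl⟩
  | succ k ih =>
    obtain ⟨j', hj'⟩ := ih (by omega)
    have h1 := (h.isSmallestNbr (k := 2 * k) (by omega)).1
    rw [hj'] at h1
    obtain ⟨i, hi⟩ := exists_eq_inl_of_adj_inr h1
    have h2 := (h.isSmallestNbr (k := 2 * k + 1) (by omega)).1
    rw [hi] at h2
    exact exists_eq_inr_of_adj_inl h2

theorem NoRevisit.parity_odd {j : C} {n : ℕ}
    (h : NoRevisit (arcHead (supportGraph x) clock) (.inr j) n) (k : ℕ) (hk : 2 * k + 1 ≤ n) :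
    ∃ i, (arcHead (supportGraph x) clock)^[2 * k + 1] (.inr j) = .inl i := by
  obtain ⟨j', hj'⟩ := h.parity k (by omega)
  have h1 := (h.isSmallestNbr hk).1
  rw [hj'] at h1
  exact exists_eq_inl_of_adj_inr h1

/-- The client at which the traversal of the chain `l` towards `j` starts. -/
def chainStart : C → List (F × C) → C
  | j, [] => j
  | _, p :: l => chainStart p.2 l

variable [Fintype F] [Fintype C]
set_option linter.unusedSectionVars false

open Classical in
/-- The facility clocks prescribe all arcs from clients to facilities along the chain `l`. -/
def FacCompat (x : F → C → ℝ) (clock : F ⊕ C → ℝ) : List (F × C) → Prop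
  | [] => True
  | p :: l => FacCompat x clock l ∧
      ∀ i ∈ facNbrs x p.2 ∪ chainFacs x l, clock (.inl p.1) ≤ clock (.inl i)

open Classical in
/-- The client clocks prescribe all arcs from facilities to clients along the chain `l` that is
continued to `j`. -/
def CliCompat (x : F → C → ℝ) (clock : F ⊕ C → ℝ) : C → List (F × C) → Prop
  | _, [] => True
  | j, p :: l => CliCompat x clock p.2 l ∧
      ∀ j' ∈ cliNbrs x p.1 ∪ chainClis x l, clock (.inr j) ≤ clock (.inr j')

/-- The members of `l` are visited by the path from `j` in its first `2 * k` steps. -/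
def OnPath (x : F → C → ℝ) (clock : F ⊕ C → ℝ) (j : C) (k : ℕ) (l : List (F × C)) : Prop :=
  ∀ q ∈ l, ∃ m < k, (arcHead (supportGraph x) clock)^[2 * m] (.inr j) = .inr q.2 ∧
    (arcHead (supportGraph x) clock)^[2 * m + 1] (.inr j) = .inl q.1

theorem NoRevisit.fac_step {j j' : C} {i : F} {k : ℕ} {l : List (F × C)}
    (h : NoRevisit (arcHead (supportGraph x) clock) (.inr j) (2 * k + 1))
    (hties : ∀ u w z, (supportGraph x).Adj w z → clock u = clock w → u = w)
    (hl : OnPath x clock j k l)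
    (hj' : (arcHead (supportGraph x) clock)^[2 * k] (.inr j) = .inr j')
    (hi : (arcHead (supportGraph x) clock)^[2 * k + 1] (.inr j) = .inl i)
    (hF : FacCompat x clock l) :
    0 < x i j' ∧ i ∉ chainFacs x l ∧ FacCompat x clock ((i, j') :: l) := by
  classical
  have h0 := (h.isSmallestNbr le_rfl).1
  rw [hj', hi] at h0
  refine ⟨adj_inr_inl.1 h0, fun hmem => ?_, hF, fun i' hi' => ?_⟩
  · obtain ⟨q, hq, hx⟩ := mem_chainFacs.1 hmem
    obtain ⟨m, hm, h1, -⟩ := hl q hq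
    obtain ⟨a, rfl⟩ := Nat.exists_eq_add_of_lt hm
    have := h.not_adj (k := 2 * m) (a := a + 1) hties (by omega) (by omega)
    rw [show 2 * m + 1 + 2 * (a + 1) = 2 * (m + a + 1) + 1 by ring, h1, hi] at this
    exact this (adj_inr_inl.2 hx)
  · rw [← hi]
    rcases Finset.mem_union.1 hi' with hmem | hmem
    · refine (h.isSmallestNbr le_rfl).2 _ ?_
      rw [hj']
      exact adj_inr_inl.2 (mem_facNbrs.1 hmem)
    · obtain ⟨q, hq, hx⟩ := mem_chainFacs.1 hmem
      obtain ⟨m, hm, h1, -⟩ := hl q hq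
      obtain ⟨a, rfl⟩ := Nat.exists_eq_add_of_lt hm
      have := h.clock_le_of_adj (k := 2 * m) (a := a + 1) (u := .inl i') (by omega)
        (by rw [h1]; exact adj_inr_inl.2 hx)
      rwa [show 2 * m + 1 + 2 * (a + 1) = 2 * (m + a + 1) + 1 by ring] at this

theorem NoRevisit.cli_step {j j' j₂ : C} {i : F} {k : ℕ} {l : List (F × C)}
    (h : NoRevisit (arcHead (supportGraph x) clock) (.inr j) (2 * k + 2))
    (hties : ∀ u w z, (supportGraph x).Adj w z → clock u = clock w → u = w)
    (hl : OnPath x clock j k l)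
    (hi : (arcHead (supportGraph x) clock)^[2 * k + 1] (.inr j) = .inl i)
    (hj' : (arcHead (supportGraph x) clock)^[2 * k + 2] (.inr j) = .inr j')
    (hC : CliCompat x clock j₂ l) :
    0 < x i j' ∧ j' ∉ chainClis x l ∧ CliCompat x clock j' ((i, j₂) :: l) := by
  classical
  have h0 := (h.isSmallestNbr le_rfl).1
  rw [hj', hi] at h0
  refine ⟨adj_inl_inr.1 h0, fun hmem => ?_, hC, fun c hc => ?_⟩
  · obtain ⟨q, hq, hx⟩ := mem_chainClis.1 hmem
    obtain ⟨m, hm, -, h1⟩ := hl q hq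
    obtain ⟨a, rfl⟩ := Nat.exists_eq_add_of_lt hm
    have := h.not_adj (k := 2 * m + 1) (a := a + 1) hties (by omega) (by omega)
    rw [show 2 * m + 1 + 1 + 2 * (a + 1) = 2 * (m + a + 1) + 2 by ring, h1, hj'] at this
    exact this (adj_inl_inr.2 hx)
  · rw [← hj']
    rcases Finset.mem_union.1 hc with hmem | hmem
    · refine (h.isSmallestNbr le_rfl).2 _ ?_
      rw [hi]
      exact adj_inl_inr.2 (mem_cliNbrs.1 hmem)
    · obtain ⟨q, hq, hx⟩ := mem_chainClis.1 hmem
      obtain ⟨m, hm, -, h1⟩ := hl q hq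
      obtain ⟨a, rfl⟩ := Nat.exists_eq_add_of_lt hm
      have := h.clock_le_of_adj (k := 2 * m + 1) (a := a + 1) (u := .inr c) (by omega)
        (by rw [h1]; exact adj_inl_inr.2 hx)
      rwa [show 2 * m + 1 + 1 + 2 * (a + 1) = 2 * (m + a + 1) + 2 by ring] at this

/-- The chain lists the visited facility–client pairs, latest first. The last clause identifies the
facility from which `j'` is entered. -/
theorem NoRevisit.exists_chain {j : C}
    (hties : ∀ u w z, (supportGraph x).Adj w z → clock u = clock w → u = w) (k : ℕ) (j' : C)
    (h : NoRevisit (arcHead (supportGraph x) clock) (.inr j) (2 * k))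
    (hj' : (arcHead (supportGraph x) clock)^[2 * k] (.inr j) = .inr j') :
    ∃ l ∈ chains F C k, chainStart j' l = j ∧ Admissible x j' l ∧ FacCompat x clock l ∧
      CliCompat x clock j' l ∧ OnPath x clock j k l ∧
      ∀ i, 0 < k → (arcHead (supportGraph x) clock)^[2 * k - 1] (.inr j) = .inl i →
        l.head?.map Prod.fst = some i := by
  induction k generalizing j' with
  | zero =>
    exact ⟨[], by simp [chains], (Sum.inr.inj hj').symm, trivial, trivial, trivial,
      by simp [OnPath], by simp⟩
  | succ k ih =>
    obtain ⟨j₂, hj₂⟩ := h.parity k (by omega)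
    obtain ⟨i, hi⟩ := h.parity_odd k (by omega)
    obtain ⟨l, hl, hs, hA, hF, hC, hP, -⟩ := ih j₂ (h.mono (by omega)) hj₂
    have hf := (h.mono (m := 2 * k + 1) (by omega)).fac_step hties hP hj₂ hi hF
    have hc := h.cli_step hties hP hi hj' hC
    refine ⟨(i, j₂) :: l, ?_, hs, ⟨hc.1, hf.1, hf.2.1, hc.2.1, hA⟩, hf.2.2, hc.2.2, ?_, ?_⟩
    · rw [mem_chains] at hl ⊢; simp [hl]
    · intro q hq
      rcases List.mem_cons.1 hq with rfl | hq
      · exact ⟨k, by omega, hj₂, hi⟩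
      · obtain ⟨m, hm, h1⟩ := hP q hq
        exact ⟨m, by omega, h1⟩
    · intro i' _ hi'
      rw [show 2 * (k + 1) - 1 = 2 * k + 1 by omega, hi] at hi'
      simpa using hi'

end Bipartite
-- Measurability of the connection graph
section Measurable
variable {V Ω : Type*} [Finite V] [MeasurableSpace Ω] {Z : V → Ω → ℝ}

/-- The clocks matter only through the relation `IsSmallestNbr`, which takes finitely many values
and is determined by finitely many comparisons of clocks. -/
theorem measurable_arcHead (hZ : ∀ v, Measurable (Z v)) (G : SimpleGraph V) :
    Measurable[_, ⊤] fun ω => arcHead G fun v => Z v ω := by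
  have hnbr : Measurable[_, ⊤] fun ω => {q : V × V | IsSmallestNbr G (fun v => Z v ω) q.1 q.2} := by
    refine @measurable_to_countable' _ _ ⊤ _ _ _ fun S => ?_
    have : (fun ω => {q : V × V | IsSmallestNbr G (fun v => Z v ω) q.1 q.2}) ⁻¹' {S} =
        ⋂ q : V × V, {ω | IsSmallestNbr G (fun v => Z v ω) q.1 q.2 ↔ q ∈ S} := by
      ext ω; simp [Set.ext_iff]
    rw [this]
    refine MeasurableSet.iInter fun q => ?_
    have hq : MeasurableSet {ω | IsSmallestNbr G (fun v => Z v ω) q.1 q.2} := by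
      have : {ω | IsSmallestNbr G (fun v => Z v ω) q.1 q.2} =
          {ω | G.Adj q.1 q.2} ∩ ⋂ u, ({ω | ¬ G.Adj q.1 u} ∪ {ω | Z q.2 ω ≤ Z u ω}) := by
        ext ω; simp [IsSmallestNbr, imp_iff_not_or]
      rw [this]
      exact (MeasurableSet.const _).inter (MeasurableSet.iInter fun u =>
        (MeasurableSet.const _).union (measurableSet_le (hZ _) (hZ _)))
    by_cases hS : q ∈ S
    · simpa [hS] using hq
    · have := hq.compl
      rw [Set.compl_ofPred] at this
      simpa only [hS, iff_false] using this
  have hfac : ∃ g : Set (V × V) → V → V, ∀ ω, arcHead G (fun v => Z v ω) =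
      g {q : V × V | IsSmallestNbr G (fun v => Z v ω) q.1 q.2} := by
    classical
    -- Any clocks inducing the relation `S` may be chosen, by `arcHead_congr`.
    refine ⟨fun S => if h : ∃ clock : V → ℝ, S = {q : V × V | IsSmallestNbr G clock q.1 q.2}
      then arcHead G h.choose else id, fun ω => ?_⟩
    have h : ∃ clock : V → ℝ, {q : V × V | IsSmallestNbr G (fun v => Z v ω) q.1 q.2} =
        {q : V × V | IsSmallestNbr G clock q.1 q.2} := ⟨_, rfl⟩
    simp only [dif_pos h]
    funext v
    refine arcHead_congr fun w => ?_
    have := Set.ext_iff.1 h.choose_spec (v, w)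
    exact this
  obtain ⟨g, hg⟩ := hfac
  simp only [hg]
  exact (@measurable_from_top _ _ ⊤ g).comp hnbr

theorem integrable_arcHead {P : Measure Ω} [IsProbabilityMeasure P] (hZ : ∀ v, Measurable (Z v))
    (G : SimpleGraph V) (h : (V → V) → ℝ) :
    Integrable (fun ω => h (arcHead G fun v => Z v ω)) P := by
  obtain ⟨B, hB⟩ := (Set.finite_range fun s => ‖h s‖).bddAbove
  refine Integrable.of_bound (C := B) ?_ (Filter.Eventually.of_forall fun ω => hB ⟨_, rfl⟩)
  exact ((@measurable_from_top _ _ _ h).comp (measurable_arcHead hZ G)).aestronglyMeasurable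

theorem measurableSet_arcHead (hZ : ∀ v, Measurable (Z v))
    (G : SimpleGraph V) (p : (V → V) → Prop) :
    MeasurableSet {ω | p (arcHead G fun v => Z v ω)} :=
  measurable_arcHead hZ G (show MeasurableSet[⊤] {s | p s} from trivial)

end Measurable

/-! ### Probability of crossing a given edge -/

section Chains
set_option linter.unusedSectionVars false
variable {F C Ω : Type*} [Fintype F] [Fintype C] [MeasurableSpace Ω] {P : Measure Ω}
  [IsProbabilityMeasure P] {Z : F ⊕ C → Ω → ℝ} {x : F → C → ℝ} {o : F → ℝ}

/-- The rates of all clocks. -/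
abbrev clockRate (C : Type*) (o : F → ℝ) : F ⊕ C → ℝ := Sum.elim o fun _ => 1

theorem chainBound_facCompat (hZ : ExpClocks (clockRate C o) Z P) (hx : Weighted x o)
    (l : List (F × C)) (j : C) (hl : Admissible x j l) :
    ChainBound (clockRate C o) Z P ((chainFacs x l).map .inl)
      {ω | FacCompat x (fun v => Z v ω) l} (facWeight x o l) := by
  classical
  induction l generalizing j with
  | nil => simpa [chainFacs, FacCompat, facWeight] using ChainBound.empty
  | cons p l ih =>
    obtain ⟨h1, h2, h3, h4, h5⟩ := hl
    have := (ih _ h5).argmin hZ (a := .inl p.1) (A := (facNbrs x p.2).map .inl) (by simpa using h3)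
      (by simpa [mem_facNbrs] using h2)
      (by simpa [mem_facNbrs] using fun i hi => hx.rate_pos hi)
    rw [← Finset.map_union, Finset.sum_map] at this
    convert this using 1
    · rw [chainFacs_cons]
    · ext ω; simp [FacCompat, or_imp, forall_and]
    · simp only [facWeight, clockRate, Function.Embedding.inl_apply, Sum.elim_inl]

theorem chainBound_cliCompat (hZ : ExpClocks (clockRate C o) Z P)
    (l : List (F × C)) (j : C) (hl : Admissible x j l) :
    ChainBound (clockRate C o) Z P ((chainClis x l).map .inr)
      {ω | CliCompat x (fun v => Z v ω) j l} (cliWeight x l) := by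
  classical
  induction l generalizing j with
  | nil => simpa [chainClis, CliCompat, cliWeight] using ChainBound.empty
  | cons p l ih =>
    obtain ⟨h1, h2, h3, h4, h5⟩ := hl
    have := (ih _ h5).argmin hZ (a := .inr j) (A := (cliNbrs x p.1).map .inr) (by simpa using h4)
      (by simpa [mem_cliNbrs] using h1) (by simp)
    rw [← Finset.map_union, Finset.sum_map] at this
    convert this using 1
    · rw [chainClis_cons]
    · ext ω; simp [CliCompat, or_imp, forall_and]
    · simp only [cliWeight, clockRate, Function.Embedding.inr_apply, Sum.elim_inr,
        Finset.sum_const, nsmul_eq_mul, mul_one]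

theorem measure_compat_le (hZ : ExpClocks (clockRate C o) Z P) (hx : Weighted x o)
    (l : List (F × C)) (j : C) (hl : Admissible x j l) :
    P.real {ω | FacCompat x (fun v => Z v ω) l ∧ CliCompat x (fun v => Z v ω) j l} ≤
      facWeight x o l * cliWeight x l :=
  (chainBound_facCompat hZ hx l j hl).inter_le hZ (chainBound_cliCompat hZ l j hl)
    (by simp [Finset.disjoint_left])

/-- Crossing from `j` to `i` adds one facility choice to the chain and no client choice. -/
theorem measure_compat_cons_le (hZ : ExpClocks (clockRate C o) Z P) (hx : Weighted x o)
    (l : List (F × C)) (i : F) (j : C) (hl : Admissible x j l) (hi : 0 < x i j) :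
    P.real {ω | i ∉ chainFacs x l ∧ FacCompat x (fun v => Z v ω) ((i, j) :: l) ∧
      CliCompat x (fun v => Z v ω) j l} ≤ o i * endWeight x o j l := by
  classical
  by_cases h3 : i ∈ chainFacs x l
  · simpa [h3] using mul_nonneg (hx.rate_nonneg i) (endWeight_nonneg hx j l)
  have h := (chainBound_facCompat hZ hx l j hl).argmin hZ (a := .inl i)
    (A := (facNbrs x j).map .inl) (by simpa using h3) (by simpa [mem_facNbrs] using hi)
    (by simpa [mem_facNbrs] using fun i hi => hx.rate_pos hi)
  have h2 := h.inter_le hZ (chainBound_cliCompat hZ l j hl)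
    (by simp [Finset.disjoint_left])
  rw [← Finset.map_union, Finset.sum_map] at h2
  convert h2 using 1
  · congr 1
    ext ω; simp [FacCompat, h3, or_imp, forall_and]
  · simp only [endWeight, clockRate, Function.Embedding.inl_apply, Sum.elim_inl]
    rw [show ∀ a b c d : ℝ, a * (b * c / d) = b * (a / d) * c by intros; ring]

/-- Ties with `w` are null once its rate is positive, and having a neighbour ensures this. -/
theorem ae_distinct (hZ : ExpClocks (clockRate C o) Z P) (hx : Weighted x o) :
    ∀ᵐ ω ∂P, ∀ u w z, (supportGraph x).Adj w z → Z u ω = Z w ω → u = w := by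
  simp only [Filter.eventually_all]
  intro u w z hwz
  by_cases huw : u = w
  · simp [huw]
  have hpos : 0 < clockRate C o w := by
    rcases w with i | j
    · obtain ⟨j, rfl⟩ := exists_eq_inr_of_adj_inl hwz
      exact hx.rate_pos (adj_inl_inr.1 hwz)
    · exact zero_lt_one
  filter_upwards [hZ.ae_ne huw hpos] with ω hω h
  exact absurd h hω

/-- If almost every outcome in `E j` has a chain from `j` in `S` for which `D` holds, the
probabilities of the `E j` add up to at most those of the `D l`. -/
theorem sum_measure_le_of_chain {S : Finset (List (F × C))} {E : C → Set Ω}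
    {D : List (F × C) → Set Ω} (j' : C)
    (h : ∀ j, ∀ᵐ ω ∂P, ω ∈ E j → ∃ l ∈ S, chainStart j' l = j ∧ ω ∈ D l) :
    ∑ j, P.real (E j) ≤ ∑ l ∈ S, P.real (D l) := by
  classical
  rw [← Finset.sum_fiberwise S (fun l => chainStart j' l)]
  refine Finset.sum_le_sum fun j _ => ?_
  refine le_trans ?_ (measureReal_biUnion_finset_le _ _)
  refine ENNReal.toReal_mono (measure_ne_top _ _) (measure_mono_ae ?_)
  filter_upwards [h j] with ω hω hE
  obtain ⟨l, hl, hs, hD⟩ := hω hE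
  exact Set.mem_biUnion (Finset.mem_coe.2 (Finset.mem_filter.2 ⟨hl, hs⟩)) hD

/-- The event that the connection path from `j` reaches `v` after `n` arcs and then `w`. -/
def TraversesAt (x : F → C → ℝ) (clock : F ⊕ C → ℝ) (j : C) (n : ℕ) (v w : F ⊕ C) : Prop :=
  NoRevisit (arcHead (supportGraph x) clock) (.inr j) (n + 1) ∧
    (arcHead (supportGraph x) clock)^[n] (.inr j) = v ∧
    (arcHead (supportGraph x) clock)^[n + 1] (.inr j) = w

/-- A chain determines its starting client, so summing over `j` counts every chain at most once and
`sum_endWeight_le` applies. -/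
theorem sum_measure_traverse_up_le (hZ : ExpClocks (clockRate C o) Z P) (hx : Weighted x o)
    (k : ℕ) (i : F) (j' : C) :
    ∑ j, P.real {ω | TraversesAt x (fun v => Z v ω) j (2 * k) (.inr j') (.inl i)} ≤
      x i j' * geo k := by
  classical
  by_cases hi : 0 < x i j'
  · rw [hx.eq_rate i j' hi]
    refine le_trans ?_ (mul_le_mul_of_nonneg_left (sum_endWeight_le hx k j') (hx.rate_nonneg i))
    rw [Finset.mul_sum]
    refine le_trans (sum_measure_le_of_chain (P := P)
      (S := (chains F C k).filter fun l => Admissible x j' l)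
      (D := fun l => {ω | i ∉ chainFacs x l ∧ FacCompat x (fun v => Z v ω) ((i, j') :: l) ∧
      CliCompat x (fun v => Z v ω) j' l}) j' ?_) (Finset.sum_le_sum fun l hl =>
      measure_compat_cons_le hZ hx l i j' (Finset.mem_filter.1 hl).2 hi)
    intro j
    filter_upwards [ae_distinct hZ hx] with ω hties ⟨hnr, h1, h2⟩
    obtain ⟨l, hl, hs, hA, hF, hC, hP, -⟩ :=
      NoRevisit.exists_chain hties k j' (hnr.mono (by omega)) h1
    have hf := hnr.fac_step hties hP h1 h2 hF
    exact ⟨l, Finset.mem_filter.2 ⟨hl, hA⟩, hs, hf.2.1, hf.2.2, hC⟩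
  · have : ∀ j, {ω | TraversesAt x (fun v => Z v ω) j (2 * k) (.inr j') (.inl i)} = ∅ := by
      intro j
      ext ω
      simp only [Set.mem_ofPred_eq, Set.mem_empty_iff_false, iff_false]
      rintro ⟨hnr, h1, h2⟩
      have := (hnr.isSmallestNbr le_rfl).1
      rw [h1, h2] at this
      exact hi (adj_inr_inl.1 this)
    simp only [this, measureReal_empty, Finset.sum_const_zero]
    exact mul_nonneg (hx.nonneg i j') (geo_nonneg k)

theorem sum_measure_traverse_down_le (hZ : ExpClocks (clockRate C o) Z P) (hx : Weighted x o)
    (k : ℕ) (i : F) (j' : C) :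
    ∑ j, P.real {ω | TraversesAt x (fun v => Z v ω) j (2 * k + 1) (.inl i) (.inr j')} ≤
      x i j' * geo k := by
  classical
  by_cases hi : 0 < x i j'
  · rw [hx.eq_rate i j' hi]
    refine le_trans ?_ (sum_chains_succ_le hx k i j')
    refine le_trans (sum_measure_le_of_chain (P := P)
      (S := (chains F C (k + 1)).filter fun l => Admissible x j' l ∧ l.head?.map Prod.fst = some i)
      (D := fun l => {ω | FacCompat x (fun v => Z v ω) l ∧
      CliCompat x (fun v => Z v ω) j' l}) j' ?_) ?_
    · intro j
      filter_upwards [ae_distinct hZ hx] with ω hties ⟨hnr, h1, h2⟩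
      obtain ⟨l, hl, hs, hA, hF, hC, hP, hh⟩ :=
        NoRevisit.exists_chain hties (k + 1) j' hnr h2
      exact ⟨l, Finset.mem_filter.2 ⟨hl, hA, hh i (by omega) h1⟩, hs, hF, hC⟩
    · refine le_trans (Finset.sum_le_sum fun l hl =>
        measure_compat_le hZ hx l j' (Finset.mem_filter.1 hl).2.1) ?_
      rw [Finset.sum_filter, sum_chains_succ, Finset.sum_eq_single i]
      · simp [Finset.sum_filter]
      · intro i' _ hne
        simp [hne]
      · simp
  · have : ∀ j, {ω | TraversesAt x (fun v => Z v ω) j (2 * k + 1) (.inl i) (.inr j')} = ∅ := by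
      intro j
      ext ω
      simp only [Set.mem_ofPred_eq, Set.mem_empty_iff_false, iff_false]
      rintro ⟨hnr, h1, h2⟩
      have := (hnr.isSmallestNbr le_rfl).1
      rw [h1, h2] at this
      exact hi (adj_inl_inr.1 this)
    simp only [this, measureReal_empty, Finset.sum_const_zero]
    exact mul_nonneg (hx.nonneg i j') (geo_nonneg k)

/-- For each neighbour `j`, `i` wins in `N(j)`, of rate 1, with probability `o i`, and independently
`j` wins in `N(i)` with probability 1/|N(i)|. -/
theorem measure_isOpened_le (hZ : ExpClocks (clockRate C o) Z P) (hx : Weighted x o) (i : F) :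
    P.real {ω | IsOpened x (fun v => Z v ω) i} ≤ o i := by
  classical
  have hsub : {ω | IsOpened x (fun v => Z v ω) i} ⊆ ⋃ j ∈ cliNbrs x i,
      {ω | FacCompat x (fun v => Z v ω) [(i, j)] ∧ CliCompat x (fun v => Z v ω) j [(i, j)]} := by
    rintro ω ⟨j, h1, h2⟩
    have h3 := isSmallestNbr_arcHead_of_ne (G := supportGraph x) (clock := fun v => Z v ω)
      (v := .inl i) (by simp [h1])
    have h4 := isSmallestNbr_arcHead_of_ne (G := supportGraph x) (clock := fun v => Z v ω)
      (v := .inr j) (by simp [h2])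
    rw [h1] at h3
    rw [h2] at h4
    have hx := adj_inl_inr.1 h3.1
    refine Set.mem_biUnion (Finset.mem_coe.2 (mem_cliNbrs.2 hx)) ⟨⟨trivial, ?_⟩, trivial, ?_⟩
    · intro i' hi'
      exact h4.2 _ (adj_inr_inl.2 (by simpa [chainFacs, mem_facNbrs] using hi'))
    · intro j' hj'
      exact h3.2 _ (adj_inl_inr.2 (by simpa [chainClis, mem_cliNbrs] using hj'))
  calc _ ≤ ∑ j ∈ cliNbrs x i, facWeight x o [(i, j)] * cliWeight x [(i, j)] := by
        refine (measureReal_mono hsub (measure_ne_top _ _)).trans ((measureReal_biUnion_finset_le _ _).trans ?_)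
        refine Finset.sum_le_sum fun j hj => measure_compat_le hZ hx _ j ?_
        simpa [Admissible, chainFacs, chainClis] using mem_cliNbrs.1 hj
    _ ≤ ∑ j ∈ cliNbrs x i, 1 / ((cliNbrs x i).card : ℝ) * o i := by
        refine Finset.sum_le_sum fun j _ => le_of_eq ?_
        simp [facWeight, cliWeight, chainFacs, chainClis, hx.sum_facNbrs, mul_comm]
    _ ≤ o i := sum_cliNbrs_le x i (hx.rate_nonneg i) fun _ => le_rfl

end Chains
-- Where two runs with the same clocks diverge
section Paths
variable {V : Type*}

/-- The range of agreement includes the first repeated vertex, which decides where the path stops.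
-/
theorem pathLength_congr [Finite V] {s s' : V → V} {v : V}
    (h : ∀ n ≤ pathLength s v + 1, s^[n] v = s'^[n] v) : pathLength s' v = pathLength s v := by
  obtain ⟨m, hm, hrev⟩ := pathLength_spec s v
  refine le_antisymm (Nat.sInf_le ⟨m, hm, ?_⟩) ?_
  · rw [← h _ le_rfl, ← h _ (by omega), hrev]
  · by_contra hlt
    obtain ⟨m', hm', hrev'⟩ := pathLength_spec s' v
    rw [← h _ (by omega), ← h _ (by omega)] at hrev'
    exact noRevisit_pathLength s v m' _ (by omega) (by omega) hrev'.symm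

theorem NoRevisit.lt_card [Fintype V] {s : V → V} {v : V} {n : ℕ} (h : NoRevisit s v n) :
    n < Fintype.card V := by
  have hinj : Function.Injective fun k : Fin (n + 1) => s^[k] v := by
    intro a b hab
    by_contra hne
    rcases lt_or_gt_of_ne hne with hlt | hlt
    · exact h a b hlt (by omega) hab
    · exact h b a hlt (by omega) hab.symm
  simpa using Fintype.card_le_of_injective _ hinj

theorem NoRevisit.exists_visit_succ {s : V → V} {v : V} {n : ℕ} (h : NoRevisit s v n) :
    ∃ m, NoRevisit s v m ∧ s^[m] v = s^[n + 1] v := by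
  by_cases hr : ∃ m ≤ n, s^[m] v = s^[n + 1] v
  · obtain ⟨m, hm, heq⟩ := hr
    exact ⟨m, h.mono hm, heq⟩
  · refine ⟨n + 1, fun a b hab hb heq => ?_, rfl⟩
    rcases Nat.lt_or_ge n b with hb' | hb'
    · obtain rfl : b = n + 1 := by omega
      exact hr ⟨a, by omega, heq⟩
    · exact h a b hab hb' heq

end Paths

open Classical in
/-- The indicator that client `j` is connected differently in `x` and in `x'`. -/
noncomputable def switchInd {F C : Type*} (x x' : F → C → ℝ) (clock : F ⊕ C → ℝ) (j : C) : ℝ :=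
  if ∃ i : F, connInd x clock i j ≠ connInd x' clock i j then 1 else 0

section Switching
variable {F C : Type*} [Fintype F] [Fintype C] {x x' : F → C → ℝ} {clock : F ⊕ C → ℝ}

theorem exists_traverse_of_visit {j z : C} {n : ℕ}
    (h : NoRevisit (arcHead (supportGraph x) clock) (.inr j) n)
    (hz : (arcHead (supportGraph x) clock)^[n] (.inr j) = .inr z) :
    z = j ∨ ∃ k < Fintype.card (F ⊕ C), ∃ i,
      TraversesAt x clock j (2 * k + 1) (.inl i) (.inr z) := by
  have hn := h.lt_card
  rcases Nat.even_or_odd' n with ⟨k, rfl | rfl⟩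
  · cases k with
    | zero => exact Or.inl (Sum.inr.inj hz).symm
    | succ k =>
      obtain ⟨i, hi⟩ := h.parity_odd k (by omega)
      exact Or.inr ⟨k, by omega, i, h, hi, hz⟩
  · obtain ⟨i, hi⟩ := h.parity_odd k le_rfl
    rw [hz] at hi
    cases hi

/-- At the first divergence both paths stand at the same vertex. If it is a client, its
neighbourhood has changed. If it is a facility and both heads are unchanged clients, each head is a
neighbour in both graphs, so their clocks tie and the heads coincide. -/
theorem exists_visit_changed {j : C}
    (hties : ∀ u w z, (supportGraph x).Adj w z → clock u = clock w → u = w)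
    (hne : assigned x clock j ≠ assigned x' clock j) :
    ∃ z ∈ changedClients x x', ∃ n,
      (NoRevisit (arcHead (supportGraph x) clock) (.inr j) n ∧
        (arcHead (supportGraph x) clock)^[n] (.inr j) = .inr z) ∨
      (NoRevisit (arcHead (supportGraph x') clock) (.inr j) n ∧
        (arcHead (supportGraph x') clock)^[n] (.inr j) = .inr z) := by
  classical
  set s := arcHead (supportGraph x) clock with hs
  set s' := arcHead (supportGraph x') clock with hs'
  have hex : ∃ n, n ≤ pathLength s (.inr j) + 1 ∧ s^[n] (.inr j) ≠ s'^[n] (.inr j) := by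
    by_contra hcon
    push Not at hcon
    refine hne ?_
    have hpath : connPath x clock j = connPath x' clock j := by
      unfold connPath
      simp only [← hs, ← hs']
      rw [pathLength_congr hcon]
      refine List.map_congr_left fun n hn => hcon n ?_
      rw [List.mem_range] at hn; omega
    rw [assigned, assigned, hpath]
  obtain ⟨hle, hdiff⟩ := Nat.find_spec hex
  have hmin : ∀ n < Nat.find hex, s^[n] (.inr j) = s'^[n] (.inr j) := fun n hn => by
    by_contra hcon
    exact Nat.find_min hex hn ⟨by omega, hcon⟩
  generalize Nat.find hex = N at hle hdiff hmin
  cases N with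
  | zero => exact absurd rfl hdiff
  | succ m =>
    have hnr : NoRevisit s (.inr j) m := (noRevisit_pathLength s _).mono (by omega)
    have hnr' : NoRevisit s' (.inr j) m := fun a b hab hb => by
      rw [← hmin a (by omega), ← hmin b (by omega)]; exact hnr a b hab hb
    have hm := hmin m (by omega)
    have hstep : s (s^[m] (.inr j)) ≠ s' (s^[m] (.inr j)) := by
      rw [Function.iterate_succ_apply', Function.iterate_succ_apply', ← hm] at hdiff
      exact hdiff
    rcases hu : s^[m] (.inr j) with i | z
    · obtain ⟨m, rfl⟩ : ∃ r, m = r + 1 := by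
        cases m with
        | zero => cases hu
        | succ r => exact ⟨r, rfl⟩
      -- The common predecessor shows that the facility is isolated in neither graph.
      have hadj := (hnr.isSmallestNbr le_rfl).1.symm
      have hadj' := (hnr'.isSmallestNbr le_rfl).1.symm
      rw [← hs, hu] at hadj
      rw [← hs', ← hm, hu] at hadj'
      have h1 := isSmallestNbr_arcHead_of_adj (clock := clock) hadj
      have h2 := isSmallestNbr_arcHead_of_adj (clock := clock) hadj'
      rw [← hs] at h1
      rw [← hs'] at h2
      obtain ⟨a, ha⟩ := exists_eq_inr_of_adj_inl h1.1
      obtain ⟨b, hb⟩ := exists_eq_inr_of_adj_inl h2.1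
      by_cases haZ : a ∈ changedClients x x'
      · obtain ⟨n, hn, heq⟩ := hnr.exists_visit_succ
        refine ⟨a, haZ, n, Or.inl ⟨hn, ?_⟩⟩
        rw [heq, Function.iterate_succ_apply', hu, ha]
      by_cases hbZ : b ∈ changedClients x x'
      · obtain ⟨n, hn, heq⟩ := hnr'.exists_visit_succ
        refine ⟨b, hbZ, n, Or.inr ⟨hn, ?_⟩⟩
        rw [heq, Function.iterate_succ_apply', ← hm, hu, hb]
      exfalso
      simp only [changedClients, Set.mem_ofPred_eq, not_exists, not_not] at haZ hbZ
      rw [ha] at h1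
      rw [hb] at h2
      have hab : (supportGraph x').Adj (.inl i) (.inr a) :=
        adj_inl_inr.2 (haZ i ▸ adj_inl_inr.1 h1.1)
      have hba : (supportGraph x).Adj (.inl i) (.inr b) :=
        adj_inl_inr.2 ((hbZ i).symm ▸ adj_inl_inr.1 h2.1)
      have := hties _ _ _ h1.1.symm (le_antisymm (h2.2 _ hab) (h1.2 _ hba))
      rw [hu, ha, hb] at hstep
      exact hstep this.symm
    · refine ⟨z, ?_, m, Or.inl ⟨hnr, hu⟩⟩
      by_contra hz
      simp only [changedClients, Set.mem_ofPred_eq, not_exists, not_not] at hz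
      refine hstep ?_
      rw [hu]
      have hadj : ∀ w, (supportGraph x).Adj (.inr z) w ↔ (supportGraph x').Adj (.inr z) w := by
        rintro (i | c)
        · rw [adj_inr_inl, adj_inr_inl, hz i]
        · simp [supportGraph]
      exact arcHead_congr fun w => by simp only [IsSmallestNbr, hadj]

open Classical in
theorem switch_le {j : C}
    (hties : ∀ u w z, (supportGraph x).Adj w z → clock u = clock w → u = w) :
    switchInd x x' clock j ≤
      (if j ∈ changedClients x x' then 1 else 0) +
      ∑ k ∈ Finset.range (Fintype.card (F ⊕ C)), ∑ i, ∑ j' : C,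
        (if j' ∈ changedClients x x' then (1 : ℝ) else 0) *
        ((if TraversesAt x clock j (2 * k + 1) (.inl i) (.inr j') then 1 else 0) +
          (if TraversesAt x' clock j (2 * k + 1) (.inl i) (.inr j') then 1 else 0)) := by
  set T : ℕ → F → C → ℝ := fun k i j' => (if j' ∈ changedClients x x' then (1 : ℝ) else 0) *
        ((if TraversesAt x clock j (2 * k + 1) (.inl i) (.inr j') then 1 else 0) +
          (if TraversesAt x' clock j (2 * k + 1) (.inl i) (.inr j') then 1 else 0)) with hT
  have hT0 : ∀ k i j', 0 ≤ T k i j' := fun k i j' => by positivity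
  have hsum0 : 0 ≤ ∑ k ∈ Finset.range (Fintype.card (F ⊕ C)), ∑ i, ∑ j', T k i j' :=
    Finset.sum_nonneg fun k _ => Finset.sum_nonneg fun i _ => Finset.sum_nonneg fun j' _ =>
      hT0 k i j'
  have hite : (0 : ℝ) ≤ if j ∈ changedClients x x' then 1 else 0 := by positivity
  unfold switchInd
  split_ifs with hsw hj hj
  · linarith
  · have hne : assigned x clock j ≠ assigned x' clock j := fun h => by
      obtain ⟨i, hi⟩ := hsw
      exact hi (by simp only [connInd, h])
    have key : ∃ k < Fintype.card (F ⊕ C), ∃ i j', 1 ≤ T k i j' := by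
      obtain ⟨z, hz, n, ⟨hn, hv⟩ | ⟨hn, hv⟩⟩ := exists_visit_changed hties hne
      · obtain rfl | ⟨k, hk, i, ht⟩ := exists_traverse_of_visit hn hv
        · exact absurd hz hj
        · refine ⟨k, hk, i, z, ?_⟩
          simp only [hT, if_pos hz, if_pos ht]
          split_ifs <;> norm_num
      · obtain rfl | ⟨k, hk, i, ht⟩ := exists_traverse_of_visit hn hv
        · exact absurd hz hj
        · refine ⟨k, hk, i, z, ?_⟩
          simp only [hT, if_pos hz, if_pos ht]
          split_ifs <;> norm_num
    obtain ⟨k, hk, i, j', h1⟩ := key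
    rw [zero_add]
    refine h1.trans ((Finset.single_le_sum (fun j' _ => hT0 k i j') (Finset.mem_univ j')).trans ?_)
    refine (Finset.single_le_sum (f := fun i => ∑ j', T k i j') (fun i _ =>
      Finset.sum_nonneg fun j' _ => hT0 k i j') (Finset.mem_univ i)).trans ?_
    exact Finset.single_le_sum (f := fun k => ∑ i, ∑ j', T k i j') (fun k _ =>
      Finset.sum_nonneg fun i _ => Finset.sum_nonneg fun j' _ => hT0 k i j')
      (Finset.mem_range.2 hk)
  · linarith
  · linarith

end Switching

/-! ### Connection cost charged to crossed edges -/

section Connection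
variable {F C : Type*} [Fintype F] [Fintype C] {x : F → C → ℝ} {clock : F ⊕ C → ℝ}

theorem sum_range_two_mul (g : ℕ → ℝ) (n : ℕ) :
    ∑ k ∈ Finset.range (2 * n), g k = ∑ k ∈ Finset.range n, (g (2 * k) + g (2 * k + 1)) := by
  induction n with
  | zero => simp
  | succ n ih =>
    rw [show 2 * (n + 1) = 2 * n + 1 + 1 by ring, Finset.sum_range_succ, Finset.sum_range_succ,
      Finset.sum_range_succ, ih]
    ring

set_option linter.unusedSectionVars false in
theorem exists_visit_of_assigned {j : C} {i : F} (h : assigned x clock j = some i) :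
    ∃ n ≤ pathLength (arcHead (supportGraph x) clock) (.inr j),
      (arcHead (supportGraph x) clock)^[n] (.inr j) = .inl i := by
  have := List.mem_of_getLast? h
  simp only [connPath, List.mem_filterMap, List.mem_map, List.mem_range] at this
  obtain ⟨v, ⟨n, hn, rfl⟩, hv⟩ := this
  exact ⟨n, by omega, Sum.getLeft?_eq_some_iff.1 hv⟩

open Classical in
theorem conn_le [PseudoMetricSpace (F ⊕ C)] (j : C) :
    ∑ i, dist (Sum.inl i : F ⊕ C) (Sum.inr j) * connInd x clock i j ≤
      ∑ k ∈ Finset.range (Fintype.card (F ⊕ C)), ∑ i : F, ∑ j' : C,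
        dist (Sum.inl i : F ⊕ C) (Sum.inr j') *
        ((if TraversesAt x clock j (2 * k) (.inr j') (.inl i) then 1 else 0) +
          (if TraversesAt x clock j (2 * k + 1) (.inl i) (.inr j') then 1 else 0)) := by
  set T : ℕ → F → C → ℝ := fun k i j' => dist (Sum.inl i : F ⊕ C) (Sum.inr j') *
        ((if TraversesAt x clock j (2 * k) (.inr j') (.inl i) then 1 else 0) +
          (if TraversesAt x clock j (2 * k + 1) (.inl i) (.inr j') then 1 else 0)) with hT
  have hT0 : ∀ k i j', 0 ≤ T k i j' := fun k i j' => by positivity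
  rcases ha : assigned x clock j with _ | i₀
  · simp only [connInd, ha, reduceCtorEq, if_false, mul_zero, Finset.sum_const_zero]
    exact Finset.sum_nonneg fun k _ => Finset.sum_nonneg fun i _ => Finset.sum_nonneg fun j' _ =>
      hT0 k i j'
  obtain ⟨L, hL, hv⟩ := exists_visit_of_assigned ha
  set p : ℕ → F ⊕ C := fun n => (arcHead (supportGraph x) clock)^[n] (.inr j) with hp
  have hnr : NoRevisit (arcHead (supportGraph x) clock) (.inr j) L :=
    (noRevisit_pathLength _ _).mono hL
  let g : ℕ → ℝ := fun n => if NoRevisit (arcHead (supportGraph x) clock) (.inr j) (n + 1) then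
    dist (p n) (p (n + 1)) else 0
  have hg0 : ∀ n, 0 ≤ g n := fun n => by simp only [g]; positivity
  calc ∑ i, dist (Sum.inl i : F ⊕ C) (Sum.inr j) * connInd x clock i j
      = dist (p 0) (p L) := by
        simp only [connInd, ha, Option.some.injEq, mul_ite, mul_one, mul_zero,
          Finset.sum_ite_eq, Finset.mem_univ, if_true]
        rw [dist_comm]
        simp only [hp, hv, Function.iterate_zero, id]
    _ ≤ ∑ n ∈ Finset.range L, dist (p n) (p (n + 1)) := dist_le_range_sum_dist p L
    _ ≤ ∑ n ∈ Finset.range L, g n := Finset.sum_le_sum fun n hn => by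
        simp only [g]
        rw [if_pos (hnr.mono (by rw [Finset.mem_range] at hn; omega))]
    -- A range independent of the outcome, long enough for every path without revisits and even, so
    -- that arcs pair up as client–facility and facility–client.
    _ ≤ ∑ n ∈ Finset.range (2 * Fintype.card (F ⊕ C)), g n := by
        refine Finset.sum_le_sum_of_subset_of_nonneg ?_ fun n _ _ => hg0 n
        have := hnr.lt_card
        exact Finset.range_subset_range.2 (by omega)
    _ = ∑ k ∈ Finset.range (Fintype.card (F ⊕ C)), (g (2 * k) + g (2 * k + 1)) :=
        sum_range_two_mul g _
    _ ≤ _ := by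
        refine Finset.sum_le_sum fun k _ => ?_
        simp only [mul_add, Finset.sum_add_distrib]
        refine add_le_add ?_ ?_
        · simp only [g]
          split_ifs with h
          · obtain ⟨j', hj'⟩ := h.parity k (by omega)
            obtain ⟨i, hi⟩ := h.parity_odd k (by omega)
            have ht : TraversesAt x clock j (2 * k) (.inr j') (.inl i) := ⟨h, hj', hi⟩
            calc dist (p (2 * k)) (p (2 * k + 1))
                = dist (Sum.inl i : F ⊕ C) (Sum.inr j') *
                  (if TraversesAt x clock j (2 * k) (.inr j') (.inl i) then 1 else 0) := by
                  rw [if_pos ht, mul_one, dist_comm]; simp only [hp, hj', hi]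
              _ ≤ _ := (Finset.single_le_sum (f := fun j' => dist (Sum.inl i : F ⊕ C) (Sum.inr j') *
                  (if TraversesAt x clock j (2 * k) (.inr j') (.inl i) then 1 else 0))
                  (fun _ _ => by positivity) (Finset.mem_univ j')).trans
                  (Finset.single_le_sum (f := fun i => ∑ j', dist (Sum.inl i : F ⊕ C)
                    (Sum.inr j') *
                  (if TraversesAt x clock j (2 * k) (.inr j') (.inl i) then 1 else 0))
                  (fun _ _ => by positivity) (Finset.mem_univ i))
          · positivity
        · simp only [g]
          split_ifs with h
          · obtain ⟨j', hj'⟩ := h.parity (k + 1) (by omega)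
            obtain ⟨i, hi⟩ := h.parity_odd k (by omega)
            have ht : TraversesAt x clock j (2 * k + 1) (.inl i) (.inr j') := ⟨h, hi, hj'⟩
            calc dist (p (2 * k + 1)) (p (2 * k + 1 + 1))
                = dist (Sum.inl i : F ⊕ C) (Sum.inr j') *
                  (if TraversesAt x clock j (2 * k + 1) (.inl i) (.inr j') then 1 else 0) := by
                  rw [if_pos ht, mul_one]; simp only [hp]; rw [hi, ht.2.2]
              _ ≤ _ := (Finset.single_le_sum (f := fun j' => dist (Sum.inl i : F ⊕ C) (Sum.inr j') *
                  (if TraversesAt x clock j (2 * k + 1) (.inl i) (.inr j') then 1 else 0))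
                  (fun _ _ => by positivity) (Finset.mem_univ j')).trans
                  (Finset.single_le_sum (f := fun i => ∑ j', dist (Sum.inl i : F ⊕ C)
                    (Sum.inr j') *
                  (if TraversesAt x clock j (2 * k + 1) (.inl i) (.inr j') then 1 else 0))
                  (fun _ _ => by positivity) (Finset.mem_univ i))
          · positivity

end Connection

/-! ### Expected connection cost and expected number of switches -/

section Expectation
variable {F C Ω : Type*} [Fintype F] [Fintype C] [MeasurableSpace Ω] {P : Measure Ω}
  [IsProbabilityMeasure P]

open Classical in
/-- Charging expected costs of clients to traversals of edges. -/
theorem sum_integral_le {A B : C → ℕ → F → C → Ω → Prop}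
    (hA : ∀ j k i j', MeasurableSet {ω | A j k i j' ω})
    (hB : ∀ j k i j', MeasurableSet {ω | B j k i j' ω}) {a b c : F → C → ℝ}
    (ha : ∀ i j, 0 ≤ a i j) (hb : ∀ i j, 0 ≤ b i j) (hc : ∀ i j, 0 ≤ c i j)
    (hAle : ∀ k i j', ∑ j, P.real {ω | A j k i j' ω} ≤ a i j' * geo k)
    (hBle : ∀ k i j', ∑ j, P.real {ω | B j k i j' ω} ≤ b i j' * geo k)
    (n : ℕ) {g : C → Ω → ℝ} (hg : ∀ j, Integrable (g j) P) (e : C → ℝ)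
    (hle : ∀ j, ∀ᵐ ω ∂P, g j ω ≤ e j + ∑ k ∈ Finset.range n, ∑ i, ∑ j',
      c i j' * ((if A j k i j' ω then 1 else 0) + (if B j k i j' ω then 1 else 0))) :
    ∑ j, ∫ ω, g j ω ∂P ≤ ∑ j, e j + 3 * ∑ i, ∑ j', c i j' * (a i j' + b i j') := by
  have hind (p : Ω → Prop) (hp : MeasurableSet {ω | p ω}) :
      Integrable (fun ω => if p ω then (1 : ℝ) else 0) P ∧
        ∫ ω, (if p ω then (1 : ℝ) else 0) ∂P = P.real {ω | p ω} := by
    have : (fun ω => if p ω then (1 : ℝ) else 0) = {ω | p ω}.indicator 1 := by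
      ext ω; simp [Set.indicator_apply]
    rw [this]
    exact ⟨(integrable_const (1 : ℝ)).indicator hp, integral_indicator_one hp⟩
  have hterm (j : C) (k : ℕ) (i : F) (j' : C) : Integrable (fun ω => c i j' *
      ((if A j k i j' ω then (1 : ℝ) else 0) + (if B j k i j' ω then 1 else 0))) P :=
    ((hind _ (hA j k i j')).1.add (hind _ (hB j k i j')).1).const_mul _
  have hsum (j : C) (k : ℕ) (i : F) : Integrable (fun ω => ∑ j', c i j' *
      ((if A j k i j' ω then (1 : ℝ) else 0) + (if B j k i j' ω then 1 else 0))) P :=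
    integrable_finsetSum _ fun j' _ => hterm j k i j'
  have hsum' (j : C) (k : ℕ) : Integrable (fun ω => ∑ i, ∑ j', c i j' *
      ((if A j k i j' ω then (1 : ℝ) else 0) + (if B j k i j' ω then 1 else 0))) P :=
    integrable_finsetSum _ fun i _ => hsum j k i
  have hj (j : C) : ∫ ω, g j ω ∂P ≤ e j + ∑ k ∈ Finset.range n, ∑ i, ∑ j', c i j' *
      (P.real {ω | A j k i j' ω} + P.real {ω | B j k i j' ω}) := by
    refine (integral_mono_ae (hg j) ((integrable_const (e j)).add
      (integrable_finsetSum _ fun k _ => hsum' j k)) (hle j)).trans_eq ?_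
    simp only [Pi.add_apply]
    rw [integral_add (integrable_const _) (integrable_finsetSum _ fun k _ => hsum' j k),
      integral_finsetSum _ fun k _ => hsum' j k]
    congr 1
    · simp
    refine Finset.sum_congr rfl fun k _ => ?_
    rw [integral_finsetSum _ fun i _ => hsum j k i]
    refine Finset.sum_congr rfl fun i _ => ?_
    rw [integral_finsetSum _ fun j' _ => hterm j k i j']
    refine Finset.sum_congr rfl fun j' _ => ?_
    rw [integral_const_mul, integral_add (hind _ (hA j k i j')).1 (hind _ (hB j k i j')).1,
      (hind _ (hA j k i j')).2, (hind _ (hB j k i j')).2]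
  refine (Finset.sum_le_sum fun j _ => hj j).trans ?_
  rw [Finset.sum_add_distrib]
  gcongr
  calc ∑ j, ∑ k ∈ Finset.range n, ∑ i, ∑ j', c i j' *
        (P.real {ω | A j k i j' ω} + P.real {ω | B j k i j' ω})
      = ∑ k ∈ Finset.range n, ∑ i, ∑ j', c i j' *
        (∑ j, P.real {ω | A j k i j' ω} + ∑ j, P.real {ω | B j k i j' ω}) := by
        rw [Finset.sum_comm]
        refine Finset.sum_congr rfl fun k _ => ?_
        rw [Finset.sum_comm]
        refine Finset.sum_congr rfl fun i _ => ?_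
        rw [Finset.sum_comm]
        refine Finset.sum_congr rfl fun j' _ => ?_
        rw [← Finset.mul_sum, Finset.sum_add_distrib]
    _ ≤ ∑ k ∈ Finset.range n, ∑ i, ∑ j', c i j' * (a i j' * geo k + b i j' * geo k) := by
        gcongr with k _ i _ j' _
        · exact hc i j'
        · exact hAle k i j'
        · exact hBle k i j'
    _ = (∑ k ∈ Finset.range n, geo k) * ∑ i, ∑ j', c i j' * (a i j' + b i j') := by
        rw [Finset.sum_mul]
        refine Finset.sum_congr rfl fun k _ => ?_
        simp only [Finset.mul_sum]
        exact Finset.sum_congr rfl fun i _ => Finset.sum_congr rfl fun j' _ => by ring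
    _ ≤ _ := by
        refine mul_le_mul_of_nonneg_right (sum_geo_le n) ?_
        exact Finset.sum_nonneg fun i _ => Finset.sum_nonneg fun j' _ =>
          mul_nonneg (hc i j') (add_nonneg (ha i j') (hb i j'))

variable {Z : F ⊕ C → Ω → ℝ} {x x' : F → C → ℝ} {o : F → ℝ}

theorem measurableSet_traversesAt (hZ : ∀ v, Measurable (Z v)) (x : F → C → ℝ) (j : C) (n : ℕ)
    (v w : F ⊕ C) : MeasurableSet {ω | TraversesAt x (fun v => Z v ω) j n v w} :=
  measurableSet_arcHead hZ (supportGraph x) fun s =>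
    NoRevisit s (.inr j) (n + 1) ∧ s^[n] (.inr j) = v ∧ s^[n + 1] (.inr j) = w

theorem integrable_openInd (hZ : ∀ v, Measurable (Z v)) (x : F → C → ℝ) (i : F) :
    Integrable (fun ω => openInd x (fun v => Z v ω) i) P := by
  exact integrable_arcHead (P := P) hZ (supportGraph x) fun s =>
    @ite ℝ (∃ j : C, s (.inl i) = .inr j ∧ s (.inr j) = .inl i) (Classical.propDecidable _) 1 0

theorem integrable_connInd (hZ : ∀ v, Measurable (Z v)) (x : F → C → ℝ) (i : F) (j : C) :
    Integrable (fun ω => connInd x (fun v => Z v ω) i j) P := by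
  classical
  exact integrable_arcHead (P := P) hZ (supportGraph x) fun s =>
    if (((List.range (pathLength s (Sum.inr j) + 1)).map fun n => s^[n] (Sum.inr j)).filterMap
      Sum.getLeft?).getLast? = some i then 1 else 0

theorem integrable_switchInd (hZ : ∀ v, Measurable (Z v)) (x x' : F → C → ℝ) (j : C) :
    Integrable (fun ω => switchInd x x' (fun v => Z v ω) j) P := by
  classical
  have hm (i : F) : MeasurableSet {ω | connInd x (fun v => Z v ω) i j ≠
      connInd x' (fun v => Z v ω) i j} := by
    have h (y : F → C → ℝ) : Measurable fun ω => connInd y (fun v => Z v ω) i j :=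
      (@measurable_from_top _ _ _ fun s : F ⊕ C → F ⊕ C =>
        if (((List.range (pathLength s (Sum.inr j) + 1)).map fun n =>
          s^[n] (Sum.inr j)).filterMap Sum.getLeft?).getLast? = some i then (1 : ℝ) else 0).comp
        (measurable_arcHead hZ (supportGraph y))
    exact (measurableSet_eq_fun (h x) (h x')).compl
  have hS : MeasurableSet {ω | ∃ i : F, connInd x (fun v => Z v ω) i j ≠
      connInd x' (fun v => Z v ω) i j} := by
    rw [Set.ofPred_exists]
    exact MeasurableSet.iUnion hm
  refine ((integrable_const (1 : ℝ)).indicator hS).congr (Filter.Eventually.of_forall fun ω => ?_)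
  simp [switchInd, Set.indicator_apply]

theorem integral_conn_le [PseudoMetricSpace (F ⊕ C)] (hZ : ExpClocks (clockRate C o) Z P)
    (hx : Weighted x o) :
    Integrable (fun ω => ∑ i : F, ∑ j : C, dist (Sum.inl i : F ⊕ C) (Sum.inr j) *
        connInd x (fun v => Z v ω) i j) P ∧
      ∫ ω, ∑ i : F, ∑ j : C, dist (Sum.inl i : F ⊕ C) (Sum.inr j) *
        connInd x (fun v => Z v ω) i j ∂P ≤
      6 * ∑ i : F, ∑ j : C, dist (Sum.inl i : F ⊕ C) (Sum.inr j) * x i j := by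
  classical
  have hint (i : F) (j : C) := (integrable_connInd (P := P) hZ.measurable x i j).const_mul
    (dist (Sum.inl i : F ⊕ C) (Sum.inr j))
  refine ⟨integrable_finsetSum _ fun i _ => integrable_finsetSum _ fun j _ => hint i j, ?_⟩
  have h := sum_integral_le (P := P)
    (A := fun j k i j' ω => TraversesAt x (fun v => Z v ω) j (2 * k) (.inr j') (.inl i))
    (B := fun j k i j' ω => TraversesAt x (fun v => Z v ω) j (2 * k + 1) (.inl i) (.inr j'))
    (fun _ _ _ _ => measurableSet_traversesAt hZ.measurable x _ _ _ _)
    (fun _ _ _ _ => measurableSet_traversesAt hZ.measurable x _ _ _ _)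
    (c := fun i j => dist (Sum.inl i : F ⊕ C) (Sum.inr j)) hx.nonneg hx.nonneg
    (fun _ _ => dist_nonneg) (sum_measure_traverse_up_le hZ hx)
    (sum_measure_traverse_down_le hZ hx) (Fintype.card (F ⊕ C))
    (g := fun j ω => ∑ i, dist (Sum.inl i : F ⊕ C) (Sum.inr j) * connInd x (fun v => Z v ω) i j)
    (fun j => integrable_finsetSum _ fun i _ => hint i j) (fun _ => 0)
    (fun j => Filter.Eventually.of_forall fun ω => by rw [zero_add]; exact conn_le j)
  rw [← integral_finsetSum _ fun j _ => integrable_finsetSum _ fun i _ => hint i j] at h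
  simp only [Finset.sum_comm (s := (Finset.univ : Finset F)) (t := (Finset.univ : Finset C))]
  simp only [Finset.sum_comm (s := (Finset.univ : Finset F)) (t := (Finset.univ : Finset C))] at h
  refine h.trans_eq ?_
  simp only [Finset.sum_const_zero, zero_add, Finset.mul_sum]
  exact Finset.sum_congr rfl fun j _ => Finset.sum_congr rfl fun i _ => by ring

/-- A changed client pays 1 for itself and, since each solution connects it with total weight 1, at
most 3 for paths entering it in each of the two runs. -/
theorem integral_switching_le (hZ : ExpClocks (clockRate C o) Z P) (hx : Weighted x o)
    (hx' : Weighted x' o) :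
    Integrable (fun ω => numSwitching x x' fun v => Z v ω) P ∧
      ∫ ω, numSwitching x x' (fun v => Z v ω) ∂P ≤ 7 * ((changedClients x x').ncard : ℝ) := by
  classical
  have hint (j : C) := integrable_switchInd (P := P) hZ.measurable x x' j
  refine ⟨integrable_finsetSum _ fun j _ => hint j, ?_⟩
  have h := sum_integral_le (P := P)
    (A := fun j k i j' ω => TraversesAt x (fun v => Z v ω) j (2 * k + 1) (.inl i) (.inr j'))
    (B := fun j k i j' ω => TraversesAt x' (fun v => Z v ω) j (2 * k + 1) (.inl i) (.inr j'))
    (fun _ _ _ _ => measurableSet_traversesAt hZ.measurable x _ _ _ _)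
    (fun _ _ _ _ => measurableSet_traversesAt hZ.measurable x' _ _ _ _)
    (c := fun _ j => if j ∈ changedClients x x' then 1 else 0) hx.nonneg hx'.nonneg
    (fun _ _ => by positivity) (sum_measure_traverse_down_le hZ hx)
    (sum_measure_traverse_down_le hZ hx') (Fintype.card (F ⊕ C)) hint
    (fun j => if j ∈ changedClients x x' then 1 else 0)
    (fun j => by
      filter_upwards [ae_distinct hZ hx] with ω hties
      exact switch_le hties)
  rw [← integral_finsetSum _ fun j _ => hint j] at h
  change ∫ ω, ∑ j, switchInd x x' (fun v => Z v ω) j ∂P ≤ _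
  refine h.trans_eq ?_
  have hcard : (∑ j : C, if j ∈ changedClients x x' then (1 : ℝ) else 0) =
      (changedClients x x').ncard := by
    rw [Finset.sum_boole, Set.ncard_eq_toFinset_card']
    congr 2; ext; simp
  rw [Finset.sum_comm]
  simp only [← Finset.mul_sum, Finset.sum_add_distrib, hx.sum_eq_one, hx'.sum_eq_one]
  rw [← Finset.sum_mul, hcard]
  ring

end Expectation
end DynFacLoc

/-! ### The three bounds at each time step -/

theorem lemma4p1 {F C : Type*} [Fintype F] [Fintype C] (T : ℕ)
    -- the instance: opening costs and a changing metric on facilities and clients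
    (f : F → ℝ) (hf : ∀ i, 0 ≤ f i)
    (d : ℕ → PseudoMetricSpace (F ⊕ C))
    -- the preprocessed LP solution
    (x : ℕ → F → C → ℝ) (y : ℕ → F → ℝ)
    (hfeas : ∀ t ∈ Finset.Icc 1 T, DynFacLoc.InPFL (x t) (y t))
    (hx : ∀ t ∈ Finset.Icc 1 T, ∀ i j, x t i j = 0 ∨ x t i j = y t i)
    (o : F → ℝ) (ho : ∀ i, o i ∈ Set.Icc (0 : ℝ) 1)
    (hy : ∀ t ∈ Finset.Icc 1 T, ∀ i, y t i = 0 ∨ y t i = o i)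
    -- the exponential clocks, one family for all time steps
    {Ω : Type*} [MeasurableSpace Ω] (P : Measure Ω) [IsProbabilityMeasure P]
    (Q : F → Ω → ℝ) (R : C → Ω → ℝ)
    (hQm : ∀ i, Measurable (Q i)) (hRm : ∀ j, Measurable (R j))
    (hQ : ∀ i, 0 < o i → HasLaw (Q i) (expMeasure (o i)) P)
    (hR : ∀ j, HasLaw (R j) (expMeasure 1) P)
    (hindep : iIndepFun (fun v : F ⊕ C => Sum.elim Q R v) P) :
    let clock : Ω → F ⊕ C → ℝ := fun ω v => Sum.elim Q R v ω
    ∀ t ∈ Finset.Icc 1 T,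
      (Integrable (fun ω => ∑ i, f i * DynFacLoc.openInd (x t) (clock ω) i) P ∧
        ∫ ω, ∑ i, f i * DynFacLoc.openInd (x t) (clock ω) i ∂P ≤ ∑ i, f i * y t i) ∧
      (Integrable (fun ω => ∑ i, ∑ j, (d t).dist (Sum.inl i) (Sum.inr j) *
          DynFacLoc.connInd (x t) (clock ω) i j) P ∧
        ∫ ω, ∑ i, ∑ j, (d t).dist (Sum.inl i) (Sum.inr j) *
            DynFacLoc.connInd (x t) (clock ω) i j ∂P ≤
          6 * ∑ i, ∑ j, (d t).dist (Sum.inl i) (Sum.inr j) * x t i j) ∧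
      (t < T →
        Integrable (fun ω => DynFacLoc.numSwitching (x t) (x (t + 1)) (clock ω)) P ∧
        ∫ ω, DynFacLoc.numSwitching (x t) (x (t + 1)) (clock ω) ∂P ≤
          7 * ((DynFacLoc.changedClients (x t) (x (t + 1))).ncard : ℝ)) := by
  intro clock t ht
  have hZ : DynFacLoc.ExpClocks (DynFacLoc.clockRate C o) (fun v : F ⊕ C => Sum.elim Q R v) P := by
    refine ⟨?_, ?_, hindep⟩
    · rintro (i | j)
      · exact hQm i
      · exact hRm j
    · rintro (i | j) hpos
      · exact hQ i hpos
      · exact hR j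
  have hw : ∀ t ∈ Finset.Icc 1 T, DynFacLoc.Weighted (x t) o := fun t ht =>
    { nonneg := (hfeas t ht).conn_nonneg
      rate_nonneg := fun i => (ho i).1
      sum_eq_one := (hfeas t ht).sum_eq_one
      eq_rate := fun i j hpos => by
        have h1 := (hx t ht i j).resolve_left hpos.ne'
        rw [h1] at hpos ⊢
        exact (hy t ht i).resolve_left hpos.ne' }
  have hopen (i : F) := DynFacLoc.integrable_openInd (P := P) hZ.measurable (x t) i
  refine ⟨⟨integrable_finsetSum _ fun i _ => (hopen i).const_mul (f i), ?_⟩, ?_, fun htT => ?_⟩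
  · rw [integral_finsetSum _ fun i _ => (hopen i).const_mul (f i)]
    refine Finset.sum_le_sum fun i _ => ?_
    rw [integral_const_mul]
    refine mul_le_mul_of_nonneg_left ?_ (hf i)
    have hreal : ∫ ω, DynFacLoc.openInd (x t) (clock ω) i ∂P =
        P.real {ω | DynFacLoc.IsOpened (x t) (clock ω) i} := by
      classical
      have hm : MeasurableSet {ω | DynFacLoc.IsOpened (x t) (clock ω) i} :=
        DynFacLoc.measurableSet_arcHead hZ.measurable (DynFacLoc.supportGraph (x t)) fun s =>
          ∃ j : C, s (.inl i) = .inr j ∧ s (.inr j) = .inl i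
      rw [← integral_indicator_one hm]
      refine integral_congr_ae (Filter.Eventually.of_forall fun ω => ?_)
      simp [DynFacLoc.openInd, Set.indicator_apply]
    refine hreal.trans_le ?_
    rcases hy t ht i with h0 | h0
    -- If `y t i = 0`, then `i` has no neighbour and cannot lie on a 2-cycle, even if `o i > 0`.
    · have hempty : {ω | DynFacLoc.IsOpened (x t) (clock ω) i} = ∅ := by
        refine Set.eq_empty_iff_forall_notMem.2 ?_
        rintro ω ⟨j, h1, -⟩
        have h2 := (DynFacLoc.isSmallestNbr_arcHead_of_ne (G := DynFacLoc.supportGraph (x t))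
          (clock := clock ω) (v := .inl i) (by simp [h1])).1
        rw [h1] at h2
        exact absurd ((DynFacLoc.adj_inl_inr.1 h2).trans_le ((hfeas t ht).le_open i j))
          (by simp [h0])
      rw [hempty, h0, measureReal_empty]
    · rw [h0]
      exact DynFacLoc.measure_isOpened_le hZ (hw t ht) i
  · let := d t
    exact DynFacLoc.integral_conn_le hZ (hw t ht)
  · rw [Finset.mem_Icc] at ht
    exact DynFacLoc.integral_switching_le hZ (hw t (Finset.mem_Icc.2 ht))
      (hw (t + 1) (Finset.mem_Icc.2 (by omega)))
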